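/- Let $\mathbb P^n$ denote complex projective $n$-space. A \emph{camera} is a real $3\times4$ matrix $P$ of rank $3$, regarded as a projection $\mathbb P^3\dashrightarrow\mathbb P^2$; its \emph{center} is the point of $\mathbb P^3$ given by $\ker P$. A \emph{configuration} $(P_1,\dots,P_n,X)$ consists of $n$ cameras with pairwise distinct centers $p_1,\dots,p_n$ and a set of points $X\subseteq\mathbb P^3$. The images of a point $x$ are the tuples $(u_1,\dots,u_n)\in(\mathbb P^2)^n$ with $u_i=P_i(x)$ whenever $x\ne p_i$ ($u_i$ being arbitrary if $x=p_i$, so that these are the limits of the joint camera map $\phi_{\mathbf P}=(P_1,\dots,P_n)$ at $x$). A configuration is a \emph{reconstruction} of $S\subseteq(\mathbb P^2)^n$ if every element of $S$ is an image of some $x\in X$ and every $x\in X$ has an image in $S$ (when $X$ contains no center: $S=\phi_{\mathbf P}(X)$). Two configurations $(P_i,X)$, $(Q_i,Y)$ are \emph{equivalent} if some $H\in\mathrm{PGL}(4,\mathbb R)$ satisfies $H(X)=Y$ and $P_iH^{-1}=Q_i$ (up to scale) for all $i$, and they are \emph{conjugate} if they are nonequivalent reconstructions of the same set. The fundamental matrix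 $F_P^{ij}$ is the $3\times 3$ matrix with $\mathbf x^TF_P^{ij}\mathbf y=\det\begin{bmatrix}P_i&\mathbf x&0\\P_j&0&\mathbf y\end{bmatrix}$. A configuration is \emph{critical} (in the non-trivial sense) if it has a \emph{non-trivial conjugate}, i.e. a conjugate configuration $(Q_1,\dots,Q_n,Y)$ such that $F_P^{ij}\neq F_Q^{ij}$, up to scale, for all $i\ne j$. A \emph{twisted cubic} is the image of the curve $\{[s^3:s^2t:st^2:t^3]\}$ under a real projective transformation of $\mathbb P^3$, and a \emph{secant} of it is a line spanned by two distinct (possibly complex) points of it. Let $(P_1,P_2,P_3,X)$ be a configuration of three cameras with centers $p_1,p_2,p_3$, and let $C\subset\mathbb P^3$ be a twisted cubic with $X\subseteq C$. 1. If $C$ passes through two of the camera centers, then $(P_1,P_2,P_3,X)$ is critical. 2. If $C$ passes through only one of the camera centers, and the two remaining centers lie on a common secant of $C$, then $(P_1,P_2,P_3,X)$ is critical. 3. If all three camera centers lie on $C$, then $(P_1,P_2,P_3,X)$ is critical, and it has a non-trivial conjugate $(Q_1,Q_2,Q_3,Y)$ whose points $Y$ all lie on a (real, irreducible) conic in a plane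 of $\mathbb P^3$ that passes through none of the centers of $Q_1,Q_2,Q_3$. -/

import Mathlib

/-- Complex projective `n`-space. -/
abbrev ProjSpace (n : ℕ) : Type := Projectivization ℂ (Fin (n + 1) → ℂ)

/-- A camera: a real `3 × 4` matrix of full rank. -/
structure Camera where
  mat : Matrix (Fin 3) (Fin 4) ℝ
  rank_eq : mat.rank = 3

namespace Camera

/-- The linear map `ℂ⁴ → ℂ³` given by the (real) camera matrix. -/
noncomputable def lin (P : Camera) : (Fin 4 → ℂ) →ₗ[ℂ] (Fin 3 → ℂ) :=
  (P.mat.map ((↑) : ℝ → ℂ)).mulVecLin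

theorem exists_ker (P : Camera) : ∃ v : Fin 4 → ℂ, v ≠ 0 ∧ P.lin v = 0 := by
  have h : LinearMap.ker P.lin ≠ ⊥ := by
    apply LinearMap.ker_ne_bot_of_finrank_lt
    simp
  obtain ⟨v, hv, hv0⟩ := (Submodule.ne_bot_iff _).1 h
  exact ⟨v, hv0, hv⟩

/-- The camera center: the point of `ℙ³` given by the kernel of the camera matrix. -/
noncomputable def center (P : Camera) : ProjSpace 3 :=
  Projectivization.mk ℂ P.exists_ker.choose P.exists_ker.choose_spec.1

/-- The kernel of the camera matrix is one-dimensional, so the center is well defined. -/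
theorem ker_lin (P : Camera) : LinearMap.ker P.lin = P.center.submodule := by
  have hle : P.center.submodule ≤ LinearMap.ker P.lin := by
    rw [center, Projectivization.submodule_mk, Submodule.span_singleton_le_iff_mem]
    exact P.exists_ker.choose_spec.2
  obtain ⟨N, hN⟩ : ∃ N : Matrix (Fin 4) (Fin 3) ℝ, P.mat * N = (1 : Matrix (Fin 3) (Fin 3) ℝ) := by
    have hs : Function.Surjective P.mat.mulVecLin := by
      rw [← LinearMap.range_eq_top]
      apply Submodule.eq_top_of_finrank_eq
      have := P.rank_eq
      simpa [Matrix.rank] using this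
    exact Matrix.mulVec_surjective_iff_exists_right_inverse.1 hs
  have hsurj : Function.Surjective P.lin := by
    have : Function.Surjective (P.mat.map ((↑) : ℝ → ℂ)).mulVec := by
      rw [Matrix.mulVec_surjective_iff_exists_right_inverse]
      refine ⟨N.map ((↑) : ℝ → ℂ), ?_⟩
      have h := congrArg (fun A => A.map Complex.ofRealHom) hN
      rw [Matrix.map_mul, Matrix.map_one _ (map_zero _) (map_one _)] at h
      exact h
    exact this
  have hdim := P.lin.finrank_range_add_finrank_ker
  rw [LinearMap.range_eq_top.2 hsurj] at hdim
  simp only [finrank_top, Module.finrank_fin_fun] at hdim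
  symm
  apply Submodule.eq_of_le_of_finrank_eq hle
  rw [Projectivization.finrank_submodule]
  change 1 = Module.finrank ℂ (LinearMap.ker P.lin)
  have h4 : Module.finrank ℂ (Fin (3 + 1) → ℂ) = 4 := by simp
  have h4' : 3 + Module.finrank ℂ (LinearMap.ker P.lin) = 4 := hdim
  omega

/-- The `6 × 6` matrix with block rows `(P, x, 0)` and `(Q, 0, y)`. -/
def blockMatrix (P Q : Camera) (x y : Fin 3 → ℝ) : Matrix (Fin 6) (Fin 6) ℝ :=
  !![P.mat 0 0, P.mat 0 1, P.mat 0 2, P.mat 0 3, x 0, 0;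
     P.mat 1 0, P.mat 1 1, P.mat 1 2, P.mat 1 3, x 1, 0;
     P.mat 2 0, P.mat 2 1, P.mat 2 2, P.mat 2 3, x 2, 0;
     Q.mat 0 0, Q.mat 0 1, Q.mat 0 2, Q.mat 0 3, 0, y 0;
     Q.mat 1 0, Q.mat 1 1, Q.mat 1 2, Q.mat 1 3, 0, y 1;
     Q.mat 2 0, Q.mat 2 1, Q.mat 2 2, Q.mat 2 3, 0, y 2]

/-- The fundamental matrix `F` of two cameras, that is the matrix of the bilinear form
`xᵀ F y = det [[P, x, 0], [Q, 0, y]]`. -/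
def fundamentalMatrix (P Q : Camera) : Matrix (Fin 3) (Fin 3) ℝ :=
  Matrix.of fun a b => (blockMatrix P Q (Pi.single a 1) (Pi.single b 1)).det

open Matrix in
theorem dotProduct_fundamentalMatrix (P Q : Camera) (x y : Fin 3 → ℝ) :
    x ⬝ᵥ (fundamentalMatrix P Q *ᵥ y) = (blockMatrix P Q x y).det := by
  have h : ∀ x y, blockMatrix P Q x y =
      ((blockMatrix P Q 0 0).updateCol 4 ![x 0, x 1, x 2, 0, 0, 0]).updateCol 5
        ![0, 0, 0, y 0, y 1, y 2] := by
    intro x y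
    ext i j
    fin_cases i <;> fin_cases j <;> simp [blockMatrix]
  have hy : ∀ x y, (blockMatrix P Q x y).det =
      ∑ b, y b * (blockMatrix P Q x (Pi.single b 1)).det := by
    intro x y
    have e : (![0, 0, 0, y 0, y 1, y 2] : Fin 6 → ℝ) =
        y 0 • ![0, 0, 0, 1, 0, 0] + y 1 • ![0, 0, 0, 0, 1, 0] + y 2 • ![0, 0, 0, 0, 0, 1] := by
      ext i; fin_cases i <;> simp
    rw [h x y, e, Matrix.det_updateCol_add, Matrix.det_updateCol_add, Matrix.det_updateCol_smul,
      Matrix.det_updateCol_smul, Matrix.det_updateCol_smul, Fin.sum_univ_three,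
      h x (Pi.single 0 1), h x (Pi.single 1 1), h x (Pi.single 2 1)]
    simp
  have hx : ∀ x y, (blockMatrix P Q x y).det =
      ∑ a, x a * (blockMatrix P Q (Pi.single a 1) y).det := by
    intro x y
    have e : (![x 0, x 1, x 2, 0, 0, 0] : Fin 6 → ℝ) =
        x 0 • ![1, 0, 0, 0, 0, 0] + x 1 • ![0, 1, 0, 0, 0, 0] + x 2 • ![0, 0, 1, 0, 0, 0] := by
      ext i; fin_cases i <;> simp
    have c : (4 : Fin 6) ≠ 5 := by decide
    rw [h x y, e, Matrix.updateCol_comm _ c, Matrix.det_updateCol_add, Matrix.det_updateCol_add,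
      Matrix.det_updateCol_smul, Matrix.det_updateCol_smul, Matrix.det_updateCol_smul,
      Fin.sum_univ_three, h (Pi.single 0 1), h (Pi.single 1 1), h (Pi.single 2 1)]
    simp [Matrix.updateCol_comm _ c]
  rw [hx]
  simp_rw [hy _ y]
  simp [dotProduct, mulVec, fundamentalMatrix, mul_comm]

end Camera

/-- Equality of matrices up to a nonzero scalar. -/
def SameUpToScale {m n : Type*} (A B : Matrix m n ℝ) : Prop :=
  ∃ c : ℝ, c ≠ 0 ∧ A = c • B

/-- A configuration: `n` cameras with pairwise distinct centers, and a set of points of `ℙ³`. -/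
structure Configuration (n : ℕ) where
  camera : Fin n → Camera
  distinct : Function.Injective fun i => (camera i).center
  points : Set (ProjSpace 3)

namespace Configuration

variable {n : ℕ}

/-- The center of the `i`-th camera. -/
noncomputable def center (A : Configuration n) (i : Fin n) : ProjSpace 3 := (A.camera i).center

/-- The images of a space point `x` under the joint camera map `ℙ³ ⇢ (ℙ²)ⁿ`: the `i`-th image
point is `Pᵢ x` if `x` is not the center of `Pᵢ`, and is arbitrary if `x` is that center.  As the
centers are distinct, this is the fibre over `x` of the closure of the graph of that map. -/
def images (A : Configuration n) (x : ProjSpace 3) : Set (Fin n → ProjSpace 2) :=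
  {u | ∀ i, x.submodule.map (A.camera i).lin ≤ (u i).submodule}

/-- `A` is a reconstruction of the set `S` of image tuples: every tuple in `S` is an image of a
point of `A`, and every point of `A` has an image in `S`.  If no point of `A` is a camera center
this says that `S` is the image of the points under the joint camera map. -/
def IsReconstruction (A : Configuration n) (S : Set (Fin n → ProjSpace 2)) : Prop :=
  (∀ u ∈ S, ∃ x ∈ A.points, u ∈ A.images x) ∧ (∀ x ∈ A.points, ∃ u ∈ S, u ∈ A.images x)

/-- Two configurations are equivalent if a real projective transformation `H` of `ℙ³` takes the
points of the first to those of the second and satisfies `Pᵢ H⁻¹ = Qᵢ` up to scale. -/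
def Equivalent (A B : Configuration n) : Prop :=
  ∃ H : Matrix.GeneralLinearGroup (Fin 4) ℝ,
    (∀ y : ProjSpace 3, y ∈ B.points ↔ ∃ x ∈ A.points,
      y.submodule = x.submodule.map
        ((H : Matrix (Fin 4) (Fin 4) ℝ).map ((↑) : ℝ → ℂ)).mulVecLin) ∧
    ∀ i, SameUpToScale
      ((A.camera i).mat * ((H⁻¹ : Matrix.GeneralLinearGroup (Fin 4) ℝ) : Matrix (Fin 4) (Fin 4) ℝ))
      (B.camera i).mat

/-- Conjugate configurations: nonequivalent reconstructions of the same set. -/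
def IsConjugate (A B : Configuration n) : Prop :=
  (∃ S, A.IsReconstruction S ∧ B.IsReconstruction S) ∧ ¬ A.Equivalent B

/-- Nontrivially conjugate configurations: conjugate, and for every pair of views the two
fundamental matrices differ (up to scale). -/
def IsNontrivialConjugate (A B : Configuration n) : Prop :=
  A.IsConjugate B ∧ ∀ i j, i ≠ j →
    ¬ SameUpToScale ((A.camera i).fundamentalMatrix (A.camera j))
      ((B.camera i).fundamentalMatrix (B.camera j))

/-- A (nontrivially) critical configuration: one that has a nontrivial conjugate. -/
def IsCritical (A : Configuration n) : Prop := ∃ B, A.IsNontrivialConjugate B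

end Configuration

/-- A (real) twisted cubic, as a set of complex points: the image of
`[s : t] ↦ [s³ : s²t : st² : t³]` under a real projective transformation. -/
def IsTwistedCubic (C : Set (ProjSpace 3)) : Prop :=
  ∃ M : Matrix.GeneralLinearGroup (Fin 4) ℝ,
    C = {x | ∃ s t : ℂ, ∃ h : ((M : Matrix (Fin 4) (Fin 4) ℝ).map ((↑) : ℝ → ℂ)).mulVec
        ![s ^ 3, s ^ 2 * t, s * t ^ 2, t ^ 3] ≠ 0,
      x = Projectivization.mk ℂ _ h}

/-- A (real) irreducible conic with real points in a plane of `ℙ³`, as a set of complex points: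
the image of `[s : t] ↦ [s² : st : t²]` under a real linear embedding `ℙ² → ℙ³`. -/
def IsConic (D : Set (ProjSpace 3)) : Prop :=
  ∃ N : Matrix (Fin 4) (Fin 3) ℝ, N.rank = 3 ∧
    D = {x | ∃ s t : ℂ, ∃ h : (N.map ((↑) : ℝ → ℂ)).mulVec ![s ^ 2, s * t, t ^ 2] ≠ 0,
      x = Projectivization.mk ℂ _ h}

/-- The line through two (distinct) points of `ℙ³`. -/
def lineThrough (a b : ProjSpace 3) : Set (ProjSpace 3) :=
  {x | x.submodule ≤ a.submodule ⊔ b.submodule}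

/-- A secant of `C`: a line spanned by two distinct points of `C`. -/
def IsSecant (L C : Set (ProjSpace 3)) : Prop :=
  ∃ a ∈ C, ∃ b ∈ C, a ≠ b ∧ L = lineThrough a b

/-!
Equivalent configurations, as well as cameras with proportional fundamental matrices, have the same
epipoles.  So it is enough to find cameras with other epipoles that see, on some curve parametrized
by `ℙ¹`, the images of the points of the cubic.

Points of a rational normal curve are contracted by a binary form to points of a rational normal
curve of lower degree with the same parameter, and a camera centered on the cubic `C` is, up to a
projective transformation of its image plane, the contraction by the linear form vanishing at its
center.  Its images of the points of `C` therefore do not change when the center slides along `C`,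
and they are also the images of the points of a plane conic under a camera centered off the plane.
The first change yields conjugates when all but one of the centers lie on `C`, the second when all
of them do.

When the off-curve centers lie on a secant, let `k` be the quadratic form with zeros at the
endpoints of the secant, so that contraction by `k` kills those centers.  Lift `C` to the rational
normal quartic in `ℙ⁴`: for every linear form `f`, contraction by `f` maps the quartic to `C` and
can be followed by an off-curve camera; the camera on `C` becomes contraction by `k`.  The space of
points of `ℙ⁴` killed by `k` is a line that contains a point `w` which suitable choices of `f` map
to all the off-curve centers at once.  All these maps then factor through the projection
from `w`, which takes the quartic to a curve in `ℙ³` and the maps to the new cameras.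
-/

open Matrix Module

section MulVec

variable {K : Type*} [Field K] {m n : ℕ}

theorem rank_eq_iff_mulVec_surjective {N : Matrix (Fin m) (Fin n) K} :
    N.rank = m ↔ Function.Surjective N.mulVec := by
  rw [← coe_mulVecLin, ← LinearMap.range_eq_top, rank]
  exact ⟨fun h => Submodule.eq_top_of_finrank_eq (h.trans (finrank_fin_fun K).symm),
    fun h => by rw [h, finrank_top, finrank_fin_fun]⟩

theorem exists_ne_zero_mulVec_eq_zero (N : Matrix (Fin n) (Fin (n + 1)) K) :
    ∃ v ≠ 0, N *ᵥ v = 0 := by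
  have hker : LinearMap.ker N.mulVecLin ≠ ⊥ := LinearMap.ker_ne_bot_of_finrank_lt (by simp)
  obtain ⟨v, hv, hv0⟩ := Submodule.exists_mem_ne_zero_of_ne_bot hker
  exact ⟨v, hv0, hv⟩

theorem mulVec_eq_zero_iff_of_surjective {N : Matrix (Fin n) (Fin (n + 1)) K}
    (hN : Function.Surjective N.mulVec) {v : Fin (n + 1) → K} (hv0 : v ≠ 0) (hv : N *ᵥ v = 0)
    {x : Fin (n + 1) → K} : N *ᵥ x = 0 ↔ ∃ c : K, c • v = x := by
  refine ⟨fun hx => ?_, ?_⟩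
  · have hker : finrank K (LinearMap.ker N.mulVecLin) = 1 := by
      have hrank := N.mulVecLin.finrank_range_add_finrank_ker
      rw [LinearMap.range_eq_top.2 hN, finrank_top, finrank_fin_fun, finrank_fin_fun] at hrank
      omega
    obtain ⟨c, hc⟩ := (finrank_eq_one_iff_of_nonzero' (K := K)
      (⟨v, hv⟩ : LinearMap.ker N.mulVecLin) (Subtype.coe_ne_coe.1 hv0)).1 hker ⟨x, hx⟩
    exact ⟨c, congrArg Subtype.val hc⟩
  · rintro ⟨c, rfl⟩
    rw [mulVec_smul, hv, smul_zero]

theorem exists_mulVec_eq_zero_iff_smul {w : Fin (n + 1) → K} (hw : w ≠ 0) :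
    ∃ E : Matrix (Fin n) (Fin (n + 1)) K,
      Function.Surjective E.mulVec ∧ ∀ x, E *ᵥ x = 0 ↔ ∃ c : K, c • w = x := by
  have hrank : finrank K ((Fin (n + 1) → K) ⧸ Submodule.span K {w}) = finrank K (Fin n → K) := by
    have := (Submodule.span K {w}).finrank_quotient_add_finrank
    rw [finrank_span_singleton hw, finrank_fin_fun] at this
    rw [finrank_fin_fun]
    omega
  let φ := (LinearEquiv.ofFinrankEq _ _ hrank).toLinearMap ∘ₗ (Submodule.span K {w}).mkQ
  refine ⟨φ.toMatrix', fun y => ?_, fun x => ?_⟩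
  · obtain ⟨x, hx⟩ :=
      ((LinearEquiv.ofFinrankEq _ _ hrank).surjective.comp (Submodule.mkQ_surjective _)) y
    exact ⟨x, (LinearMap.toMatrix'_mulVec φ x).trans hx⟩
  · rw [LinearMap.toMatrix'_mulVec, LinearMap.comp_apply, LinearEquiv.coe_coe,
      LinearEquiv.map_eq_zero_iff, Submodule.mkQ_apply, Submodule.Quotient.mk_eq_zero,
      Submodule.mem_span_singleton]

theorem exists_eq_mul_of_ker_le {l : Type*} {N : Matrix (Fin m) (Fin n) K}
    {R : Matrix l (Fin n) K} (hN : Function.Surjective N.mulVec)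
    (hker : ∀ x, N *ᵥ x = 0 → R *ᵥ x = 0) : ∃ G : Matrix l (Fin m) K, R = G * N := by
  obtain ⟨N', hN'⟩ := mulVec_surjective_iff_exists_right_inverse.1 hN
  refine ⟨R * N', ext_of_mulVec_single fun j => ?_⟩
  have hx := hker (Pi.single j 1 - N' *ᵥ N *ᵥ Pi.single j 1) (by
    simp only [mulVec_sub, mulVec_mulVec, ← Matrix.mul_assoc, hN', Matrix.one_mul, sub_self])
  simpa only [mulVec_sub, mulVec_mulVec, sub_eq_zero, Matrix.mul_assoc] using hx

end MulVec

section Forms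

variable {K : Type*} [Field K]

/-- The point `[s ^ (n - 1) : s ^ (n - 2) * t : ⋯ : t ^ (n - 1)]` of the rational normal curve, as a
vector with `n` coordinates. -/
def veronese (n : ℕ) (s t : K) : Fin n → K := fun i => s ^ (i.rev : ℕ) * t ^ (i : ℕ)

/-- Contraction by the binary form `∑ k, f k * s ^ (d - 1 - k) * t ^ k`, whose coefficients `f` are
also those of the polynomial `Polynomial.ofFn d f`.  It is meant for `m + d = N + 1`: then row `i`
of the matrix lists the coefficients of `s ^ (m - 1 - i) * t ^ i * f`. -/
def contraction {d : ℕ} (m N : ℕ) : (Fin d → K) →ₗ[K] Matrix (Fin m) (Fin N) K where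
  toFun f := of fun i j => ∑ k : Fin d, if (i : ℕ) + k = j then f k else 0
  map_add' f g := by
    ext i j
    simp [← Finset.sum_add_distrib, ite_add_ite]
  map_smul' c f := by
    ext i j
    simp [Finset.mul_sum]

theorem contraction_apply {d m N : ℕ} (f : Fin d → K) (i : Fin m) (j : Fin N) :
    contraction m N f i j = ∑ k : Fin d, if (i : ℕ) + k = j then f k else 0 :=
  rfl

theorem contraction_mulVec_apply {d m N : ℕ} (h : m + d = N + 1) (f : Fin d → K) (x : Fin N → K)
    (i : Fin m) :
    (contraction m N f *ᵥ x) i = ∑ k : Fin d, f k * x ⟨i + k, by omega⟩ := by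
  simp only [mulVec, dotProduct, contraction_apply, Finset.sum_mul, ite_mul, zero_mul]
  rw [Finset.sum_comm]
  refine Finset.sum_congr rfl fun k _ => ?_
  rw [Finset.sum_eq_single ⟨i + k, by omega⟩]
  · simp
  · exact fun j _ hj => if_neg fun hij => hj (Fin.ext hij.symm)
  · simp

theorem contraction_mulVec_veronese {d m N : ℕ} (h : m + d = N + 1) (f : Fin d → K) (s t : K) :
    contraction m N f *ᵥ veronese N s t = (f ⬝ᵥ veronese d s t) • veronese m s t := by
  ext i
  rw [contraction_mulVec_apply h, Pi.smul_apply, smul_eq_mul, dotProduct, Finset.sum_mul]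
  refine Finset.sum_congr rfl fun k _ => ?_
  have hrev : N - (i + k + 1) = d - (k + 1) + (m - (i + 1)) := by omega
  simp only [veronese, Fin.val_rev, hrev, pow_add]
  ring

open Polynomial in
theorem ofFn_contraction_apply [DecidableEq K] {d m N : ℕ} (h : m + d = N + 1) (f : Fin d → K)
    (i : Fin m) :
    ofFn N (contraction m N f i) = X ^ (i : ℕ) * ofFn d f := by
  ext j
  rw [coeff_X_pow_mul', ofFn_eq_sum_monomial f]
  simp only [finsetSum_coeff, coeff_monomial]
  rcases lt_or_ge j N with hj | hj
  · rw [ofFn_coeff_eq_val_of_lt _ hj, contraction_apply]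
    split_ifs with hij
    · exact Finset.sum_congr rfl fun k _ => if_congr (by simp only; omega) rfl rfl
    · exact Finset.sum_eq_zero fun k _ => if_neg (by simp only; omega)
  · rw [ofFn_coeff_eq_zero_of_ge _ hj, if_pos (by omega)]
    exact (Finset.sum_eq_zero fun k _ => if_neg (by omega)).symm

open Polynomial in
theorem ofFn_vecMul_contraction [DecidableEq K] {d e D : ℕ} (h : e + d = D + 1) (g : Fin e → K)
    (f : Fin d → K) :
    ofFn D (g ᵥ* contraction e D f) = ofFn e g * ofFn d f := by
  rw [vecMul_eq_sum, map_sum, ofFn_eq_sum_monomial g, Finset.sum_mul]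
  refine Finset.sum_congr rfl fun i _ => ?_
  rw [map_smul, ofFn_contraction_apply h, smul_eq_C_mul, ← mul_assoc, C_mul_X_pow_eq_monomial]

theorem vecMul_contraction_comm {d e D : ℕ} (h : e + d = D + 1) (g : Fin e → K) (f : Fin d → K) :
    g ᵥ* contraction e D f = f ᵥ* contraction d D g := by
  classical
  apply Polynomial.injective_ofFn D
  rw [ofFn_vecMul_contraction h, ofFn_vecMul_contraction (by omega), mul_comm]

theorem contraction_mul_contraction {d e D l m N : ℕ} (hD : e + d = D + 1) (hm : l + e = m + 1)
    (hN : m + d = N + 1) (g : Fin e → K) (f : Fin d → K) :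
    contraction l m g * contraction m N f = contraction l N (g ᵥ* contraction e D f) := by
  classical
  refine funext fun i => Polynomial.injective_ofFn N ?_
  change Polynomial.ofFn N (contraction l m g i ᵥ* contraction m N f) = _
  rw [ofFn_vecMul_contraction hN, ofFn_contraction_apply hm, ofFn_contraction_apply (by omega),
    ofFn_vecMul_contraction hD, mul_assoc]

theorem contraction_mulVec_comm {d e l m m' N : ℕ} (hm : l + e = m + 1) (hN : m + d = N + 1)
    (hm' : l + d = m' + 1) (hde : 0 < e + d) (g : Fin e → K) (f : Fin d → K) (x : Fin N → K) :
    contraction l m g *ᵥ contraction m N f *ᵥ x =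
      contraction l m' f *ᵥ contraction m' N g *ᵥ x := by
  obtain ⟨D, hD⟩ : ∃ D, e + d = D + 1 := ⟨e + d - 1, by omega⟩
  simp only [mulVec_mulVec]
  rw [contraction_mul_contraction hD hm hN,
    contraction_mul_contraction (D := D) (by omega) hm' (by omega), vecMul_contraction_comm hD]

theorem vecMul_contraction_ne_zero {d e D : ℕ} (h : e + d = D + 1) {g : Fin e → K} {f : Fin d → K}
    (hg : g ≠ 0) (hf : f ≠ 0) : g ᵥ* contraction e D f ≠ 0 := by
  classical
  rw [← map_ne_zero_iff _ (Polynomial.injective_ofFn _)] at hg hf ⊢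
  rw [ofFn_vecMul_contraction h]
  exact mul_ne_zero hg hf

theorem contraction_mulVec_surjective {d m N : ℕ} (h : m + d = N + 1) {f : Fin d → K} (hf : f ≠ 0) :
    Function.Surjective (contraction m N f).mulVec := by
  have hinj : Function.Injective (contraction m N f).vecMulLinear :=
    (injective_iff_map_eq_zero _).2 fun g hg => by
      by_contra hg0
      exact vecMul_contraction_ne_zero h hg0 hf hg
  rw [← rank_eq_iff_mulVec_surjective,
    LinearIndependent.rank_matrix (vecMul_injective_iff.1 hinj), Fintype.card_fin]

theorem finrank_ker_contraction {d m N : ℕ} (h : m + d = N + 1) {f : Fin d → K} (hf : f ≠ 0) :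
    finrank K (LinearMap.ker (contraction m N f).mulVecLin) + 1 = d := by
  have hrank := (contraction m N f).mulVecLin.finrank_range_add_finrank_ker
  rw [LinearMap.range_eq_top.2 (contraction_mulVec_surjective h hf), finrank_top, finrank_fin_fun,
    finrank_fin_fun] at hrank
  omega

theorem exists_eq_vecMul_contraction {d m N : ℕ} (h : m + d = N + 1) {f : Fin d → K} (hf : f ≠ 0)
    {k : Fin N → K} (hk : ∀ x, contraction m N f *ᵥ x = 0 → k ⬝ᵥ x = 0) :
    ∃ g, k = g ᵥ* contraction m N f := by
  obtain ⟨G, hG⟩ := exists_eq_mul_of_ker_le (R := of ![k]) (contraction_mulVec_surjective h hf)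
    fun x hx => funext fun _ => by simpa using hk x hx
  exact ⟨G 0, congrFun hG 0⟩

theorem veronese_zero_zero (n : ℕ) : veronese (n + 2) (0 : K) 0 = 0 := by
  ext i
  simp only [veronese, Fin.val_rev, Pi.zero_apply, mul_eq_zero, pow_eq_zero_iff', true_and]
  omega

theorem veronese_ne_zero (n : ℕ) {s t : K} (h : s ≠ 0 ∨ t ≠ 0) : veronese (n + 1) s t ≠ 0 := by
  intro h0
  rcases h with hs | ht
  · exact pow_ne_zero n hs (by simpa [veronese] using congrFun h0 0)
  · exact pow_ne_zero n ht (by simpa [veronese] using congrFun h0 (Fin.last n))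

/-- The point of the rational normal curve at the zero of a linear form `f`. -/
def root (n : ℕ) (f : Fin 2 → K) : Fin n → K := veronese n (f 1) (-f 0)

theorem contraction_mulVec_root {d m N : ℕ} (h : m + d = N + 1) (f : Fin d → K) (g : Fin 2 → K) :
    contraction m N f *ᵥ root N g = (f ⬝ᵥ root d g) • root m g :=
  contraction_mulVec_veronese h f _ _

theorem dotProduct_root (f : Fin 2 → K) : f ⬝ᵥ root 2 f = 0 := by
  simp [root, veronese, dotProduct, mul_comm]

theorem contraction_mulVec_root_self (m : ℕ) (f : Fin 2 → K) :
    contraction m (m + 1) f *ᵥ root (m + 1) f = 0 := by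
  rw [contraction_mulVec_root (by omega), dotProduct_root, zero_smul]

theorem root_ne_zero (n : ℕ) {f : Fin 2 → K} (hf : f ≠ 0) : root (n + 1) f ≠ 0 := by
  refine veronese_ne_zero n ?_
  by_contra! h
  exact hf (funext (Fin.forall_fin_two.2 ⟨neg_eq_zero.1 h.2, h.1⟩))

theorem contraction_mulVec_eq_zero_iff {m : ℕ} {f : Fin 2 → K} (hf : f ≠ 0)
    {x : Fin (m + 1) → K} : contraction m (m + 1) f *ᵥ x = 0 ↔ ∃ c : K, c • root (m + 1) f = x :=
  mulVec_eq_zero_iff_of_surjective (contraction_mulVec_surjective (by omega) hf)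
    (root_ne_zero m hf) (contraction_mulVec_root_self m f)

open Polynomial in
theorem eval_ofFn [DecidableEq K] {n : ℕ} (f : Fin n → K) (θ : K) :
    (ofFn n f).eval θ = f ⬝ᵥ veronese n 1 θ := by
  simp [ofFn_eq_sum_monomial, eval_finsetSum, veronese, dotProduct]

theorem finite_setOf_veronese_mem {n : ℕ} {W : Submodule K (Fin n → K)} (hW : W ≠ ⊤) :
    {θ : K | veronese n 1 θ ∈ W}.Finite := by
  classical
  obtain ⟨φ, hφ, hWφ⟩ := Submodule.exists_le_ker_of_lt_top W hW.lt_top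
  obtain ⟨f, rfl⟩ := (dotProductEquiv K (Fin n)).surjective φ
  have hf : Polynomial.ofFn n f ≠ 0 :=
    (map_ne_zero_iff _ (Polynomial.injective_ofFn n)).2 fun h => hφ (by rw [h, map_zero])
  refine (Polynomial.finite_setOfPred_isRoot hf).subset fun θ hθ => ?_
  rw [Set.mem_ofPred_eq, Polynomial.IsRoot, eval_ofFn]
  exact hWφ hθ

theorem root_eq_veronese (n : ℕ) (s t : K) : root n ![-t, s] = veronese n s t := by
  simp [root]

theorem vec_neg_ne_zero {s t : K} (h : s ≠ 0 ∨ t ≠ 0) : ![-t, s] ≠ 0 := fun h0 =>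
  h.elim (fun hs => hs (congrFun h0 1)) fun ht => ht (neg_eq_zero.1 (congrFun h0 0))

theorem exists_forms_root_notMem [Infinite K] {ι : Type*} [Finite ι] {n : ℕ}
    {W : ι → Submodule K (Fin n → K)} (hW : ∀ i, W i ≠ ⊤) :
    ∃ g : ι → Fin 2 → K, (∀ i, g i ≠ 0) ∧ (Pairwise fun i j => g i ⬝ᵥ root 2 (g j) ≠ 0) ∧
      ∀ i j, root n (g i) ∉ W j := by
  have hinf : (⋃ j, {θ : K | veronese n 1 θ ∈ W j})ᶜ.Infinite :=
    (Set.finite_iUnion fun j => finite_setOf_veronese_mem (hW j)).infinite_compl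
  let θ := (Finite.equivFin ι).toEmbedding.trans (Fin.valEmbedding.trans (hinf.natEmbedding _))
  refine ⟨fun i => ![-θ i, 1], fun i => vec_neg_ne_zero (Or.inl one_ne_zero),
    fun i j hij => ?_, fun i j hij => (θ i).2 (Set.mem_iUnion.2 ⟨j, ?_⟩)⟩
  · have hdot : ![-(θ i : K), 1] ⬝ᵥ root 2 ![-(θ j : K), 1] = θ j - θ i := by
      simp [root, veronese, dotProduct, Fin.sum_univ_two, neg_add_eq_sub]
    exact hdot.trans_ne (sub_ne_zero.2 (Subtype.val_injective.ne (θ.injective.ne hij.symm)))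
  · rwa [root_eq_veronese] at hij

theorem exists_contraction_mulVec_eq [Infinite K] {d m N : ℕ} (h : m + d = N + 1) {k : Fin d → K}
    (hk : k ≠ 0) {p : Fin N → K} (hp : contraction m N k *ᵥ p = 0) :
    ∃ (l : Fin 2 → K) (w : Fin (N + 1) → K),
      contraction (m + 1) (N + 1) k *ᵥ w = 0 ∧ contraction N (N + 1) l *ᵥ w = p := by
  obtain ⟨θ, hθ⟩ : ∃ θ : K, k ⬝ᵥ veronese d 1 θ ≠ 0 := by
    have hW : LinearMap.ker (dotProductEquiv K (Fin d) k) ≠ ⊤ := fun h =>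
      hk ((LinearEquiv.map_eq_zero_iff _).1 (LinearMap.ker_eq_top.1 h))
    exact (finite_setOf_veronese_mem hW).exists_notMem
  have hθ0 : (![-θ, 1] : Fin 2 → K) ≠ 0 := vec_neg_ne_zero (Or.inl one_ne_zero)
  have hmap : ∀ x ∈ LinearMap.ker (contraction (m + 1) (N + 1) k).mulVecLin,
      (contraction N (N + 1) ![-θ, 1]).mulVecLin x ∈ LinearMap.ker (contraction m N k).mulVecLin :=
    fun x (hx : contraction (m + 1) (N + 1) k *ᵥ x = 0) => by
      rw [LinearMap.mem_ker, mulVecLin_apply, mulVecLin_apply, contraction_mulVec_comm (m' := m + 1)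
        (by omega) (by omega) (by omega) (by omega), hx, mulVec_zero]
  have hinj : Function.Injective ((contraction N (N + 1) ![-θ, 1]).mulVecLin.restrict hmap) := by
    refine (injective_iff_map_eq_zero _).2 fun ⟨x, hx⟩ hx0 => Subtype.ext ?_
    obtain ⟨c, rfl⟩ := (contraction_mulVec_eq_zero_iff hθ0).1 (congrArg Subtype.val hx0)
    rw [LinearMap.mem_ker, mulVecLin_apply, mulVec_smul, root_eq_veronese,
      contraction_mulVec_veronese (by omega)] at hx
    have hc : c = 0 := (smul_eq_zero.1 hx).resolve_right
      (smul_ne_zero hθ (veronese_ne_zero m (Or.inl one_ne_zero)))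
    simp only [hc, zero_smul, Submodule.coe_zero]
  have hrank : finrank K (LinearMap.ker (contraction (m + 1) (N + 1) k).mulVecLin) =
      finrank K (LinearMap.ker (contraction m N k).mulVecLin) :=
    Nat.succ_injective ((finrank_ker_contraction (by omega) hk).trans
      (finrank_ker_contraction h hk).symm)
  obtain ⟨⟨w, hw⟩, hwp⟩ :=
    (LinearMap.injective_iff_surjective_of_finrank_eq_finrank hrank).1 hinj ⟨p, hp⟩
  exact ⟨![-θ, 1], w, hw, congrArg Subtype.val hwp⟩

theorem exists_forall_contraction_mulVec_eq [Infinite K] {m N : ℕ} (h : m + 3 = N + 1)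
    {k : Fin 3 → K} (hk : k ≠ 0) {p : Fin N → K} (hp : contraction m N k *ᵥ p = 0)
    (hpf : ∀ f : Fin 2 → K, contraction (m + 1) N f *ᵥ p = 0 → f = 0) :
    ∃ w : Fin (N + 1) → K, contraction (m + 1) (N + 1) k *ᵥ w = 0 ∧
      (∀ f : Fin 2 → K, contraction N (N + 1) f *ᵥ w = 0 → f = 0) ∧
      ∀ r, contraction m N k *ᵥ r = 0 → ∃ f : Fin 2 → K, contraction N (N + 1) f *ᵥ w = r := by
  obtain ⟨l, w, hkw, rfl⟩ := exists_contraction_mulVec_eq h hk hp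
  have hinj (f : Fin 2 → K) (hf : contraction N (N + 1) f *ᵥ w = 0) : f = 0 := by
    apply hpf
    rw [contraction_mulVec_comm (m' := N) (by omega) (by omega) (by omega) (by omega), hf,
      mulVec_zero]
  let T : (Fin 2 → K) →ₗ[K] LinearMap.ker (contraction m N k).mulVecLin :=
    (((mulVecBilin K K).flip w).comp (contraction N (N + 1))).codRestrict _ fun f => by
      change contraction m N k *ᵥ contraction N (N + 1) f *ᵥ w = 0
      rw [contraction_mulVec_comm (m' := m + 1) (by omega) (by omega) (by omega) (by omega), hkw,
        mulVec_zero]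
  have hrank : finrank K (Fin 2 → K) = finrank K (LinearMap.ker (contraction m N k).mulVecLin) := by
    rw [finrank_fin_fun]
    exact Nat.succ_injective (finrank_ker_contraction h hk).symm
  have hT : Function.Injective T :=
    (injective_iff_map_eq_zero T).2 fun f hf => hinj f (congrArg Subtype.val hf)
  refine ⟨w, hkw, hinj, fun r hr => ?_⟩
  obtain ⟨f, hf⟩ :=
    (LinearMap.injective_iff_surjective_of_finrank_eq_finrank hrank).1 hT ⟨r, hr⟩
  exact ⟨f, congrArg Subtype.val hf⟩

theorem dotProduct_root_ne_zero {d m N : ℕ} (h : m + d = N + 1)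
    {k : Fin (d + 1) → K} (hk : k ≠ 0) {w : Fin (N + 1) → K} {f : Fin 2 → K} (hf : f ≠ 0)
    (hkw : contraction m (N + 1) k *ᵥ w = 0)
    (hfw : ∀ g : Fin d → K, contraction m N g *ᵥ contraction N (N + 1) f *ᵥ w = 0 → g = 0) :
    k ⬝ᵥ root (d + 1) f ≠ 0 := by
  intro hroot
  obtain ⟨g, rfl⟩ : ∃ g : Fin d → K, k = g ᵥ* contraction d (d + 1) f := by
    refine exists_eq_vecMul_contraction (by omega) hf fun x hx => ?_
    obtain ⟨c, rfl⟩ := (contraction_mulVec_eq_zero_iff hf).1 hx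
    rw [dotProduct_smul, hroot, smul_zero]
  rw [← contraction_mul_contraction (m := N) (by omega) (by omega) (by omega),
    ← mulVec_mulVec] at hkw
  exact hk (by rw [hfw g hkw, zero_vecMul])

end Forms

section RealComplex

open Complex (ofReal)

variable {l m n : Type*} [Fintype n]

theorem map_ofReal_mul (N : Matrix l n ℝ) (R : Matrix n m ℝ) :
    (N * R).map ofReal = N.map ofReal * R.map ofReal :=
  Matrix.map_mul (f := Complex.ofRealHom)

theorem map_ofReal_mulVec (N : Matrix m n ℝ) (v : n → ℝ) :
    N.map ofReal *ᵥ (ofReal ∘ v) = ofReal ∘ (N *ᵥ v) :=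
  funext fun i => (Complex.ofRealHom.map_mulVec N v i).symm

theorem ofReal_comp_ne_zero {n : Type*} {v : n → ℝ} (hv : v ≠ 0) : ofReal ∘ v ≠ 0 := fun h =>
  hv (funext fun i => Complex.ofReal_eq_zero.1 (congrFun h i))

theorem map_ofReal_mulVec_eq_zero_iff {N : Matrix m n ℝ} {v : n → ℝ} :
    N.map ofReal *ᵥ (ofReal ∘ v) = 0 ↔ N *ᵥ v = 0 := by
  rw [map_ofReal_mulVec]
  exact ⟨not_imp_not.1 ofReal_comp_ne_zero, fun h => by simp [h]⟩

theorem map_ofReal_mulVec_surjective {m n : ℕ} {N : Matrix (Fin m) (Fin n) ℝ}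
    (hN : Function.Surjective N.mulVec) : Function.Surjective (N.map ofReal).mulVec := by
  obtain ⟨N', hN'⟩ := mulVec_surjective_iff_exists_right_inverse.1 hN
  refine mulVec_surjective_iff_exists_right_inverse.2 ⟨N'.map ofReal, ?_⟩
  rw [← map_ofReal_mul, hN', Matrix.map_one _ Complex.ofReal_zero Complex.ofReal_one]

theorem map_ofReal_mulVec_injective {n : ℕ} {G : Matrix (Fin n) (Fin n) ℝ} (hG : IsUnit G) :
    Function.Injective (G.map ofReal).mulVec :=
  mulVec_injective_iff_isUnit.2 <| mulVec_surjective_iff_isUnit.1 <|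
    map_ofReal_mulVec_surjective (mulVec_surjective_iff_isUnit.2 hG)

theorem map_ofReal_contraction {d m N : ℕ} (f : Fin d → ℝ) :
    (contraction m N f).map ofReal = contraction m N (ofReal ∘ f) := by
  ext i j
  simp [contraction_apply, apply_ite ofReal]

theorem exists_real_contraction {d : ℕ} {f : Fin d → ℂ} (hf : f ≠ 0) :
    ∃ g : Fin d → ℝ, g ≠ 0 ∧ ∀ {m N : ℕ} (v : Fin N → ℝ),
      contraction m N f *ᵥ (ofReal ∘ v) = 0 → contraction m N g *ᵥ v = 0 := by
  have hpart (φ : ℂ →ₗ[ℝ] ℝ) {m N : ℕ} (v : Fin N → ℝ)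
      (hv : contraction m N f *ᵥ (ofReal ∘ v) = 0) : contraction m N (φ ∘ f) *ᵥ v = 0 := by
    ext i
    have hi := congrArg φ (congrFun hv i)
    simp only [mulVec, dotProduct, Function.comp_apply, mul_comm _ (ofReal _), ← Complex.real_smul,
      map_sum, map_smul, contraction_apply, Pi.zero_apply, map_zero, smul_eq_mul,
      apply_ite φ] at hi ⊢
    simpa only [mul_comm] using hi
  by_cases hre : Complex.re ∘ f = 0
  · refine ⟨Complex.im ∘ f, fun him => hf (funext fun i => ?_), hpart Complex.imLm⟩
    exact Complex.ext (congrFun hre i) (congrFun him i)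
  · exact ⟨Complex.re ∘ f, hre, hpart Complex.reLm⟩

end RealComplex

section Epipole

variable {l m n n' : ℕ}

/-- The epipole of `Q` as seen by `P`, that is the image under `P` of the center (the kernel) of
`Q`, as a subspace of the image space of `P`. -/
def epipole (P : Matrix (Fin l) (Fin n) ℝ) (Q : Matrix (Fin m) (Fin n) ℝ) :
    Submodule ℝ (Fin l → ℝ) :=
  (LinearMap.ker Q.mulVecLin).map P.mulVecLin

variable {P P' : Matrix (Fin l) (Fin n) ℝ} {Q Q' : Matrix (Fin m) (Fin n) ℝ}

theorem mem_epipole {x : Fin l → ℝ} : x ∈ epipole P Q ↔ ∃ v, Q *ᵥ v = 0 ∧ P *ᵥ v = x :=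
  Iff.rfl

theorem epipole_mul_right {E : Matrix (Fin n) (Fin n') ℝ} (hE : Function.Surjective E.mulVec) :
    epipole (P * E) (Q * E) = epipole P Q := by
  ext x
  simp only [mem_epipole, ← mulVec_mulVec]
  exact (hE.exists (p := fun v => Q *ᵥ v = 0 ∧ P *ᵥ v = x)).symm

theorem SameUpToScale.ker_mulVecLin_eq {l n : Type*} [Fintype n] {P P' : Matrix l n ℝ}
    (h : SameUpToScale P P') : LinearMap.ker P.mulVecLin = LinearMap.ker P'.mulVecLin := by
  obtain ⟨c, hc, rfl⟩ := h
  ext x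
  simp [hc]

theorem SameUpToScale.epipole_eq (hP : SameUpToScale P P') (hQ : SameUpToScale Q Q') :
    epipole P Q = epipole P' Q' := by
  rw [epipole, epipole, hQ.ker_mulVecLin_eq]
  obtain ⟨c, hc, rfl⟩ := hP
  have hsmul : (c • P').mulVecLin = c • P'.mulVecLin := by
    ext
    simp
  rw [hsmul, Submodule.map_smul _ _ c hc]

end Epipole

theorem eq_mk_of_mem_submodule {K V : Type*} [Field K] [AddCommGroup V] [Module K V]
    {x : Projectivization K V} {v : V} (hv : v ≠ 0) (h : v ∈ x.submodule) :
    x = Projectivization.mk K v hv := by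
  rw [Projectivization.submodule_eq, Submodule.mem_span_singleton] at h
  conv_lhs => rw [← x.mk_rep]
  exact ((Projectivization.mk_eq_mk_iff' K v x.rep hv x.rep_nonzero).2 h).symm

theorem append_eq_zero_iff {α : Type*} [Zero α] {m n : ℕ} {a : Fin m → α} {b : Fin n → α} :
    Fin.append a b = 0 ↔ a = 0 ∧ b = 0 := by
  simp [funext_iff, Fin.forall_fin_add]

namespace Camera

open Complex (ofReal)

variable {P Q : Camera}

theorem mulVec_surjective (P : Camera) : Function.Surjective P.mat.mulVec :=
  rank_eq_iff_mulVec_surjective.1 P.rank_eq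

theorem ofReal_mem_center {v : Fin 4 → ℝ} : ofReal ∘ v ∈ P.center.submodule ↔ P.mat *ᵥ v = 0 := by
  rw [← ker_lin]
  exact map_ofReal_mulVec_eq_zero_iff (N := P.mat)

theorem eq_zero_of_center_ne (h : P.center ≠ Q.center) {v : Fin 4 → ℝ} (hP : P.mat *ᵥ v = 0)
    (hQ : Q.mat *ᵥ v = 0) : v = 0 := by
  by_contra hv
  exact h ((eq_mk_of_mem_submodule (ofReal_comp_ne_zero hv) (ofReal_mem_center.2 hP)).trans
    (eq_mk_of_mem_submodule (ofReal_comp_ne_zero hv) (ofReal_mem_center.2 hQ)).symm)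

theorem epipole_eq_bot_of_center_eq (h : P.center = Q.center) : epipole P.mat Q.mat = ⊥ := by
  rw [eq_bot_iff]
  rintro _ ⟨v, hv, rfl⟩
  exact ofReal_mem_center.1 (h ▸ ofReal_mem_center.2 hv)

theorem blockMatrix_mulVec (P Q : Camera) (x y : Fin 3 → ℝ) (v : Fin 4 → ℝ) (c : Fin 2 → ℝ) :
    blockMatrix P Q x y *ᵥ Fin.append v c =
      Fin.append (P.mat *ᵥ v + c 0 • x) (Q.mat *ᵥ v + c 1 • y) := by
  ext i
  fin_cases i <;>
    simp [blockMatrix, mulVec, dotProduct, Fin.sum_univ_succ, Fin.append, Fin.addCases] <;> ring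

theorem det_blockMatrix_eq_zero_iff {x y : Fin 3 → ℝ} :
    (blockMatrix P Q x y).det = 0 ↔ ∃ (v : Fin 4 → ℝ) (c : Fin 2 → ℝ), (v ≠ 0 ∨ c ≠ 0) ∧
      P.mat *ᵥ v + c 0 • x = 0 ∧ Q.mat *ᵥ v + c 1 • y = 0 := by
  rw [← exists_mulVec_eq_zero_iff, (Fin.appendEquiv 4 2).surjective.exists, Prod.exists]
  refine exists₂_congr fun v c => and_congr ?_ ?_
  · exact (not_congr append_eq_zero_iff).trans not_and_or
  · change blockMatrix P Q x y *ᵥ Fin.append v c = 0 ↔ _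
    rw [blockMatrix_mulVec, append_eq_zero_iff]

theorem det_blockMatrix_eq_zero_of_swap {x y : Fin 3 → ℝ} (h : (blockMatrix P Q x y).det = 0) :
    (blockMatrix Q P y x).det = 0 := by
  obtain ⟨v, c, hne, hP, hQ⟩ := det_blockMatrix_eq_zero_iff.1 h
  refine det_blockMatrix_eq_zero_iff.2 ⟨v, ![c 1, c 0], hne.imp_right fun hc h0 => hc ?_, hQ, hP⟩
  exact funext (Fin.forall_fin_two.2 ⟨congrFun h0 1, congrFun h0 0⟩)

theorem mem_epipole_iff_forall_det_eq_zero (h : P.center ≠ Q.center) {x : Fin 3 → ℝ} :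
    x ∈ epipole P.mat Q.mat ↔ ∀ y, (blockMatrix P Q x y).det = 0 := by
  simp only [mem_epipole, det_blockMatrix_eq_zero_iff]
  refine ⟨fun ⟨v, hQ, hP⟩ y => ⟨v, ![-1, 0], by simp, by simp [hP], by simp [hQ]⟩, fun hx => ?_⟩
  obtain ⟨v, hv⟩ := P.mulVec_surjective x
  obtain ⟨p, hp0, hp⟩ := exists_ne_zero_mulVec_eq_zero P.mat
  obtain ⟨y, hy⟩ : ∃ y, y ∉ Submodule.span ℝ {Q.mat *ᵥ v, Q.mat *ᵥ p} := by
    by_contra! hspan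
    have hcard := finrank_range_le_card (R := ℝ) ![Q.mat *ᵥ v, Q.mat *ᵥ p]
    rw [range_cons_cons_empty, Set.finrank, Submodule.eq_top_iff'.2 hspan, finrank_top] at hcard
    simp at hcard
  obtain ⟨u, c, hne, hPu, hQu⟩ := hx y
  have hker : P.mat *ᵥ (u + c 0 • v) = 0 := by rw [mulVec_add, mulVec_smul, hv, hPu]
  obtain ⟨d, hd⟩ := (mulVec_eq_zero_iff_of_surjective P.mulVec_surjective hp0 hp).1 hker
  have hc1 : c 1 = 0 := by
    by_contra hc1
    have hmem : c 1 • y ∈ Submodule.span ℝ {Q.mat *ᵥ v, Q.mat *ᵥ p} := by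
      refine Submodule.mem_span_pair.2 ⟨c 0, -d, ?_⟩
      rw [neg_smul, ← mulVec_smul, ← mulVec_smul, hd, mulVec_add, eq_neg_of_add_eq_zero_left hQu]
      abel
    exact hy ((Submodule.smul_mem_iff _ hc1).1 hmem)
  rw [hc1, zero_smul, add_zero] at hQu
  have hc0 : c 0 ≠ 0 := by
    intro hc0
    rw [hc0, zero_smul, add_zero] at hPu
    refine hne.elim (fun hu => hu (eq_zero_of_center_ne h hPu hQu)) fun hc => hc ?_
    exact funext (Fin.forall_fin_two.2 ⟨hc0, hc1⟩)
  refine ⟨(-c 0)⁻¹ • u, by rw [mulVec_smul, hQu, smul_zero], ?_⟩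
  rw [mulVec_smul, eq_neg_of_add_eq_zero_left hPu, ← neg_smul, inv_smul_smul₀ (neg_ne_zero.2 hc0)]

variable {P' Q' : Camera}

theorem epipole_eq_of_det_eq_zero_iff (h : P.center ≠ Q.center) (h' : P'.center ≠ Q'.center)
    (hdet : ∀ x y, (blockMatrix P Q x y).det = 0 ↔ (blockMatrix P' Q' x y).det = 0) :
    epipole P.mat Q.mat = epipole P'.mat Q'.mat := by
  ext x
  rw [mem_epipole_iff_forall_det_eq_zero h, mem_epipole_iff_forall_det_eq_zero h']
  exact forall_congr' (hdet x)

theorem epipoles_eq_of_sameUpToScale (h : P.center ≠ Q.center) (h' : P'.center ≠ Q'.center)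
    (hF : SameUpToScale (P.fundamentalMatrix Q) (P'.fundamentalMatrix Q')) :
    epipole P.mat Q.mat = epipole P'.mat Q'.mat ∧ epipole Q.mat P.mat = epipole Q'.mat P'.mat := by
  obtain ⟨c, hc, hF⟩ := hF
  have hdet (x y) : (blockMatrix P Q x y).det = 0 ↔ (blockMatrix P' Q' x y).det = 0 := by
    rw [← dotProduct_fundamentalMatrix, hF, smul_mulVec, dotProduct_smul, smul_eq_zero_iff_right hc,
      dotProduct_fundamentalMatrix]
  have hswap {P Q : Camera} {x y} :
      (blockMatrix P Q x y).det = 0 ↔ (blockMatrix Q P y x).det = 0 :=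
    ⟨det_blockMatrix_eq_zero_of_swap, det_blockMatrix_eq_zero_of_swap⟩
  exact ⟨epipole_eq_of_det_eq_zero_iff h h' hdet, epipole_eq_of_det_eq_zero_iff h.symm h'.symm
    fun x y => hswap.trans ((hdet y x).trans hswap)⟩

end Camera

section VeroneseCurve

open Complex (ofReal)

/-- The image in `ℙ³` of the rational normal curve with `n` coordinates under a real linear map;
this includes twisted cubics (`n = 4`) and plane conics (`n = 3`). -/
def veroneseCurve {n : ℕ} (M : Matrix (Fin 4) (Fin n) ℝ) : Set (ProjSpace 3) :=
  {x | ∃ s t : ℂ, ∃ h : M.map ofReal *ᵥ veronese n s t ≠ 0, x = Projectivization.mk ℂ _ h}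

theorem exists_eq_mk_of_mem_veroneseCurve {n : ℕ} {M : Matrix (Fin 4) (Fin (n + 2)) ℝ}
    {x : ProjSpace 3} (hx : x ∈ veroneseCurve M) :
    ∃ s t : ℂ, (s ≠ 0 ∨ t ≠ 0) ∧
      ∃ h : M.map ofReal *ᵥ veronese (n + 2) s t ≠ 0, x = Projectivization.mk ℂ _ h := by
  obtain ⟨s, t, h, rfl⟩ := hx
  refine ⟨s, t, ?_, h, rfl⟩
  by_contra! h0
  exact h (by rw [h0.1, h0.2, veronese_zero_zero, mulVec_zero])

theorem isTwistedCubic_iff {C : Set (ProjSpace 3)} :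
    IsTwistedCubic C ↔ ∃ M : GL (Fin 4) ℝ, C = veroneseCurve M.val := by
  have hver (s t : ℂ) : ![s ^ 3, s ^ 2 * t, s * t ^ 2, t ^ 3] = veronese 4 s t := by
    ext i
    fin_cases i <;> simp [veronese]
  simp only [IsTwistedCubic, hver]
  rfl

theorem isConic_iff {D : Set (ProjSpace 3)} :
    IsConic D ↔ ∃ N : Matrix (Fin 4) (Fin 3) ℝ, N.rank = 3 ∧ D = veroneseCurve N := by
  have hver (s t : ℂ) : ![s ^ 2, s * t, t ^ 2] = veronese 3 s t := by
    ext i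
    fin_cases i <;> simp [veronese]
  simp only [IsConic, hver]
  rfl

theorem exists_span_le_submodule {n : ℕ} (v : Fin (n + 1) → ℂ) :
    ∃ x : ProjSpace n, Submodule.span ℂ {v} ≤ x.submodule := by
  rcases eq_or_ne v 0 with rfl | hv
  · exact ⟨Projectivization.mk ℂ 1 one_ne_zero, by simp⟩
  · exact ⟨Projectivization.mk ℂ v hv, (Projectivization.submodule_mk v hv).ge⟩

/-- The camera given by a surjective matrix. -/
def Camera.ofSurjective {N : Matrix (Fin 3) (Fin 4) ℝ} (hN : Function.Surjective N.mulVec) :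
    Camera :=
  ⟨N, rank_eq_iff_mulVec_surjective.2 hN⟩

theorem Camera.map_submodule_mk_le_iff {P : Camera} {v : Fin 4 → ℂ} (hv : v ≠ 0)
    {W : Submodule ℂ (Fin 3 → ℂ)} :
    (Projectivization.mk ℂ v hv).submodule.map P.lin ≤ W ↔ P.mat.map ofReal *ᵥ v ∈ W := by
  rw [Projectivization.submodule_mk, Submodule.map_span_le]
  simp only [Set.mem_singleton_iff, forall_eq]
  rfl

end VeroneseCurve

namespace Configuration

open Complex (ofReal)

variable {n : ℕ}

theorem Equivalent.epipole_eq {A B : Configuration n} (h : A.Equivalent B) (i j : Fin n) :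
    epipole (A.camera i).mat (A.camera j).mat = epipole (B.camera i).mat (B.camera j).mat := by
  obtain ⟨H, -, hH⟩ := h
  rw [← (hH i).epipole_eq (hH j),
    epipole_mul_right (mulVec_surjective_iff_isUnit.2 (Units.isUnit H⁻¹))]

theorem exists_isNontrivialConjugate [Nontrivial (Fin n)] {A : Configuration n} (Q : Fin n → Camera)
    (hne : Pairwise fun i j =>
      ¬(epipole (Q i).mat (Q j).mat ≤ epipole (A.camera i).mat (A.camera j).mat ∧
        epipole (Q j).mat (Q i).mat ≤ epipole (A.camera j).mat (A.camera i).mat))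
    (D : Set (ProjSpace 3))
    (hD : ∀ x ∈ A.points, ∃ y ∈ D, ∃ u ∈ A.images x,
      ∀ i, y.submodule.map (Q i).lin ≤ (u i).submodule) :
    ∃ B : Configuration n, B.camera = Q ∧ B.points ⊆ D ∧ A.IsNontrivialConjugate B := by
  have hcenter {i j : Fin n} (hij : i ≠ j) : (Q i).center ≠ (Q j).center := fun h => hne hij
    ⟨(Camera.epipole_eq_bot_of_center_eq h).trans_le bot_le,
      (Camera.epipole_eq_bot_of_center_eq h.symm).trans_le bot_le⟩
  let B : Configuration n :=
    { camera := Q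
      distinct := fun i j h => not_imp_not.1 hcenter h
      points := {y ∈ D | ∃ x ∈ A.points, ∃ u ∈ A.images x,
        ∀ i, y.submodule.map (Q i).lin ≤ (u i).submodule} }
  have hS : A.IsReconstruction {u | ∃ x ∈ A.points, u ∈ A.images x ∧ ∃ y ∈ D, u ∈ B.images y} := by
    refine ⟨fun u ⟨x, hx, hu, _⟩ => ⟨x, hx, hu⟩, fun x hx => ?_⟩
    obtain ⟨y, hy, u, hu, huy⟩ := hD x hx
    exact ⟨u, ⟨x, hx, hu, y, hy, huy⟩, hu⟩
  have hS' : B.IsReconstruction {u | ∃ x ∈ A.points, u ∈ A.images x ∧ ∃ y ∈ D, u ∈ B.images y} :=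
    ⟨fun u ⟨x, hx, hu, y, hy, huy⟩ => ⟨y, ⟨hy, x, hx, u, hu, huy⟩, huy⟩,
      fun y ⟨hy, x, hx, u, hu, huy⟩ => ⟨u, ⟨x, hx, hu, y, hy, huy⟩, huy⟩⟩
  refine ⟨B, rfl, fun y hy => hy.1, ⟨⟨_, hS, hS'⟩, fun h => ?_⟩, fun i j hij h => hne hij ?_⟩
  · obtain ⟨i, j, hij⟩ := exists_pair_ne (Fin n)
    exact hne hij ⟨(h.epipole_eq i j).ge, (h.epipole_eq j i).ge⟩
  · exact (Camera.epipoles_eq_of_sameUpToScale (A.distinct.ne hij) (hcenter hij) h).imp Eq.ge Eq.ge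

theorem exists_isNontrivialConjugate_of_subset_veroneseCurve [Nontrivial (Fin n)]
    {A : Configuration n} {M : GL (Fin 4) ℝ} (hX : A.points ⊆ veroneseCurve M.val)
    {Q : Fin n → Matrix (Fin 3) (Fin 4) ℝ} (hQ : ∀ i, Function.Surjective (Q i).mulVec)
    {l : Fin n} (hne : ∀ i j, i ≠ j → j ≠ l → ¬epipole (Q i) (Q j) ≤
      epipole ((A.camera i).mat * M.val) ((A.camera j).mat * M.val))
    (D : Set (ProjSpace 3))
    (hD : ∀ s t : ℂ, s ≠ 0 ∨ t ≠ 0 → ∃ (y : Fin 4 → ℂ) (hy : y ≠ 0),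
      Projectivization.mk ℂ y hy ∈ D ∧ ∀ i, ∃ u : Fin 3 → ℂ,
        ((A.camera i).mat * M.val).map ofReal *ᵥ veronese 4 s t ∈ Submodule.span ℂ {u} ∧
        (Q i).map ofReal *ᵥ y ∈ Submodule.span ℂ {u}) :
    ∃ B : Configuration n, (∀ i, (B.camera i).mat = Q i) ∧ B.points ⊆ D ∧
      A.IsNontrivialConjugate B := by
  have hM : Function.Surjective M.val.mulVec := mulVec_surjective_iff_isUnit.2 M.isUnit
  simp only [epipole_mul_right hM] at hne
  have hcommon : ∀ x ∈ A.points, ∃ y ∈ D, ∃ u ∈ A.images x,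
      ∀ i, y.submodule.map (Camera.ofSurjective (hQ i)).lin ≤ (u i).submodule := by
    intro x hx
    obtain ⟨s, t, hst, _, rfl⟩ := exists_eq_mk_of_mem_veroneseCurve (hX hx)
    obtain ⟨y, hy, hyD, hu⟩ := hD s t hst
    choose u hux huy using hu
    choose z hz using fun i => exists_span_le_submodule (u i)
    refine ⟨_, hyD, z, fun i => ?_, fun i => ?_⟩
    · rw [Camera.map_submodule_mk_le_iff, mulVec_mulVec, ← map_ofReal_mul]
      exact hz i (hux i)
    · rw [Camera.map_submodule_mk_le_iff]
      exact hz i (huy i)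
  have hpair : Pairwise fun i j => ¬(epipole (Q i) (Q j) ≤
      epipole (A.camera i).mat (A.camera j).mat ∧
        epipole (Q j) (Q i) ≤ epipole (A.camera j).mat (A.camera i).mat) := by
    intro i j hij h
    rcases eq_or_ne j l with rfl | hj
    · exact hne j i hij.symm hij h.2
    · exact hne i j hij hj h.1
  obtain ⟨B, hB, hBD⟩ :=
    exists_isNontrivialConjugate (fun i => Camera.ofSurjective (hQ i)) hpair D hcommon
  exact ⟨B, fun i => congrArg Camera.mat (congrFun hB i), hBD⟩

end Configuration

section CenterPosition

open Complex (ofReal)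

variable {P : Camera} {M : GL (Fin 4) ℝ}

theorem Camera.mat_mul_mulVec_surjective (P : Camera) (M : GL (Fin 4) ℝ) :
    Function.Surjective (P.mat * M.val).mulVec := by
  have hcomp := P.mulVec_surjective.comp (mulVec_surjective_iff_isUnit.2 M.isUnit)
  simpa only [Function.comp_def, mulVec_mulVec] using hcomp

theorem Camera.mulVec_mem_center {x : Fin 4 → ℂ} :
    M.val.map ofReal *ᵥ x ∈ P.center.submodule ↔ (P.mat * M.val).map ofReal *ᵥ x = 0 := by
  rw [← P.ker_lin, map_ofReal_mul, ← mulVec_mulVec]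
  rfl

theorem exists_eq_mul_contraction_of_center_mem (h : P.center ∈ veroneseCurve M.val) :
    ∃ f : Fin 2 → ℝ, f ≠ 0 ∧ ∃ G : Matrix (Fin 3) (Fin 3) ℝ, IsUnit G ∧
      P.mat * M.val = G * contraction 3 4 f := by
  have hsurj := P.mat_mul_mulVec_surjective M
  obtain ⟨s, t, hst, hMγ, hc⟩ := exists_eq_mk_of_mem_veroneseCurve h
  have hker : (P.mat * M.val).map ofReal *ᵥ veronese 4 s t = 0 := by
    rw [← Camera.mulVec_mem_center, hc, Projectivization.submodule_mk]
    exact Submodule.mem_span_singleton_self _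
  obtain ⟨p, hp0, hp⟩ := exists_ne_zero_mulVec_eq_zero (P.mat * M.val)
  obtain ⟨f, hf0, hf⟩ := exists_real_contraction (vec_neg_ne_zero hst)
  have hfp : contraction 3 4 f *ᵥ p = 0 := hf p <| by
    obtain ⟨c, hc⟩ := (mulVec_eq_zero_iff_of_surjective (map_ofReal_mulVec_surjective hsurj)
      (veronese_ne_zero 3 hst) hker).1 (map_ofReal_mulVec_eq_zero_iff.2 hp)
    rw [← hc, mulVec_smul, ← root_eq_veronese, contraction_mulVec_root_self, smul_zero]
  have hfsurj := contraction_mulVec_surjective (m := 3) (N := 4) (by omega) hf0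
  obtain ⟨G, hG⟩ := exists_eq_mul_of_ker_le (R := P.mat * M.val) hfsurj fun x hx => by
    obtain ⟨c, rfl⟩ := (mulVec_eq_zero_iff_of_surjective hfsurj hp0 hfp).1 hx
    rw [mulVec_smul, hp, smul_zero]
  refine ⟨f, hf0, G, mulVec_surjective_iff_isUnit.1 ?_, hG⟩
  refine Function.Surjective.of_comp (g := (contraction 3 4 f).mulVec) ?_
  simpa only [Function.comp_def, mulVec_mulVec, ← hG] using hsurj

theorem center_mem_of_contraction_eq_zero {f : Fin 2 → ℝ} (hf : f ≠ 0) {p : Fin 4 → ℝ} (hp0 : p ≠ 0)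
    (hp : (P.mat * M.val) *ᵥ p = 0) (hfp : contraction 3 4 f *ᵥ p = 0) :
    P.center ∈ veroneseCurve M.val := by
  obtain ⟨c, rfl⟩ := (contraction_mulVec_eq_zero_iff hf).1 hfp
  have hc : (c : ℂ) ≠ 0 := fun h => hp0 (by rw [Complex.ofReal_eq_zero.1 h, zero_smul])
  have hroot : ofReal ∘ (c • root 4 f) = (c : ℂ) • veronese 4 (f 1 : ℂ) (-f 0 : ℂ) := by
    ext i
    simp [root, veronese]
  have hmem := Camera.mulVec_mem_center.2 (map_ofReal_mulVec_eq_zero_iff.2 hp)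
  rw [hroot, mulVec_smul, Submodule.smul_mem_iff _ hc] at hmem
  have hne : M.val.map ofReal *ᵥ veronese 4 (f 1 : ℂ) (-f 0 : ℂ) ≠ 0 := fun h0 =>
    ofReal_comp_ne_zero hp0 (map_ofReal_mulVec_injective M.isUnit (by
      simp only [hroot, mulVec_smul, h0, smul_zero, mulVec_zero]))
  exact ⟨_, _, hne, eq_mk_of_mem_submodule hne hmem⟩

theorem exists_contraction_eq_zero_of_isSecant {L : Set (ProjSpace 3)}
    (hL : IsSecant L (veroneseCurve M.val)) :
    ∃ k : Fin 3 → ℝ, k ≠ 0 ∧ ∀ P : Camera, P.center ∈ L → ∀ p,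
      (P.mat * M.val) *ᵥ p = 0 → contraction 2 4 k *ᵥ p = 0 := by
  obtain ⟨a, ha, b, hb, -, rfl⟩ := hL
  obtain ⟨s, t, hst, _, rfl⟩ := exists_eq_mk_of_mem_veroneseCurve ha
  obtain ⟨s', t', hst', _, rfl⟩ := exists_eq_mk_of_mem_veroneseCurve hb
  obtain ⟨k, hk0, hk⟩ := exists_real_contraction <|
    vecMul_contraction_ne_zero (D := 3) (by omega) (vec_neg_ne_zero hst) (vec_neg_ne_zero hst')
  refine ⟨k, hk0, fun P hP p hp => hk p ?_⟩
  rw [← contraction_mul_contraction (m := 3) (by omega) (by omega) (by omega), ← mulVec_mulVec]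
  have hspan := hP (Camera.mulVec_mem_center.2 (map_ofReal_mulVec_eq_zero_iff.2 hp))
  rw [Projectivization.submodule_mk, Projectivization.submodule_mk, ← Submodule.span_insert,
    Submodule.mem_span_pair] at hspan
  obtain ⟨α, β, hαβ⟩ := hspan
  rw [← mulVec_smul, ← mulVec_smul, ← mulVec_add] at hαβ
  rw [← map_ofReal_mulVec_injective M.isUnit hαβ, mulVec_add, mulVec_smul, mulVec_smul,
    ← root_eq_veronese 4 s' t', contraction_mulVec_root_self, smul_zero, add_zero, mulVec_smul,
    contraction_mulVec_comm (m' := 3) (by omega) (by omega) (by omega) (by omega),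
    ← root_eq_veronese, contraction_mulVec_root_self, mulVec_zero, smul_zero]

end CenterPosition

section Conjugates

open Complex (ofReal)

variable {n : ℕ}

theorem exists_mulVec_eq_of_epipole_le {k l l' m m' : ℕ} {P : Matrix (Fin k) (Fin l) ℝ}
    {Q : Matrix (Fin m) (Fin l) ℝ} {P' : Matrix (Fin k) (Fin l') ℝ}
    {Q' : Matrix (Fin m') (Fin l') ℝ}
    (h : epipole P Q ≤ epipole P' Q') {x : Fin l → ℝ} (hx : Q *ᵥ x = 0) :
    ∃ v, Q' *ᵥ v = 0 ∧ P' *ᵥ v = P *ᵥ x :=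
  mem_epipole.1 (h (mem_epipole.2 ⟨x, hx, rfl⟩))

theorem ker_le_sup_ker_of_epipole_le {k l m m' : ℕ} {P : Matrix (Fin k) (Fin l) ℝ}
    {Q : Matrix (Fin m) (Fin l) ℝ} {Q' : Matrix (Fin m') (Fin l) ℝ}
    (h : epipole P Q ≤ epipole P Q') :
    LinearMap.ker Q.mulVecLin ≤ LinearMap.ker P.mulVecLin ⊔ LinearMap.ker Q'.mulVecLin := by
  intro x hx
  obtain ⟨v, hv, hPv⟩ := exists_mulVec_eq_of_epipole_le h hx
  refine Submodule.mem_sup.2 ⟨x - v, ?_, v, hv, sub_add_cancel x v⟩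
  rw [LinearMap.mem_ker, mulVecLin_apply, mulVec_sub, hPv, sub_self]

theorem mul_mulVec_eq_zero_iff {k l : ℕ} {G : Matrix (Fin k) (Fin k) ℝ} (hG : IsUnit G)
    {R : Matrix (Fin k) (Fin l) ℝ} {x : Fin l → ℝ} : (G * R) *ᵥ x = 0 ↔ R *ᵥ x = 0 := by
  rw [← mulVec_mulVec]
  exact (mulVec_injective_iff_isUnit.2 hG).eq_iff' (mulVec_zero G)

theorem mul_mulVec_surjective {k l : ℕ} {G : Matrix (Fin k) (Fin k) ℝ} (hG : IsUnit G)
    {R : Matrix (Fin k) (Fin l) ℝ} (hR : Function.Surjective R.mulVec) :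
    Function.Surjective (G * R).mulVec := by
  simpa only [Function.comp_def, mulVec_mulVec] using
    (mulVec_surjective_iff_isUnit.2 hG).comp hR

theorem mul_contraction_mulVec_root_eq_zero_of_epipole_le {k : ℕ}
    {G G' : Matrix (Fin (k + 2)) (Fin (k + 2)) ℝ} (hG : IsUnit G) (hG' : IsUnit G')
    {f f' g g' : Fin 2 → ℝ} (hg' : g' ≠ 0) (hgg' : g ⬝ᵥ root 2 g' ≠ 0)
    (h : epipole (G * contraction (k + 2) (k + 3) g) (G' * contraction (k + 2) (k + 3) g') ≤
      epipole (G * contraction (k + 2) (k + 3) f) (G' * contraction (k + 2) (k + 3) f')) :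
    (G' * contraction (k + 2) (k + 3) f') *ᵥ root (k + 3) g' = 0 := by
  obtain ⟨v, hv, hv'⟩ := exists_mulVec_eq_of_epipole_le h
    ((mul_mulVec_eq_zero_iff hG').2 (contraction_mulVec_root_self (k + 2) g'))
  rw [mul_mulVec_eq_zero_iff hG'] at hv
  rw [← mulVec_mulVec, ← mulVec_mulVec] at hv'
  replace hv' := mulVec_injective_iff_isUnit.2 hG hv'
  rw [contraction_mulVec_root (by omega)] at hv'
  have hdot : f' ⬝ᵥ root 2 g' = 0 := by
    have hcomm := contraction_mulVec_comm (l := k + 1) (m := k + 2) (m' := k + 2) (by omega)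
      (by omega) (by omega) (by omega) f f' v
    rw [hv, hv', mulVec_zero, mulVec_smul, contraction_mulVec_root (by omega)] at hcomm
    simpa only [smul_eq_zero, hgg', root_ne_zero k hg', false_or, or_false] using hcomm.symm
  rw [mul_mulVec_eq_zero_iff hG', contraction_mulVec_root (by omega), hdot, zero_smul]

theorem ker_sup_ker_ne_top {k l : ℕ} (hkl : l < 2 * k) {R R' : Matrix (Fin k) (Fin l) ℝ}
    (hR : Function.Surjective R.mulVec) (hR' : Function.Surjective R'.mulVec) :
    LinearMap.ker R.mulVecLin ⊔ LinearMap.ker R'.mulVecLin ≠ ⊤ := by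
  intro h
  have hfinrank {S : Matrix (Fin k) (Fin l) ℝ} (hS : Function.Surjective S.mulVec) :
      k + finrank ℝ (LinearMap.ker S.mulVecLin) = l := by
    have hrank := S.mulVecLin.finrank_range_add_finrank_ker
    rwa [LinearMap.range_eq_top.2 hS, finrank_top, finrank_fin_fun, finrank_fin_fun] at hrank
  have hadd := Submodule.finrank_add_le_finrank_add_finrank (LinearMap.ker R.mulVecLin)
    (LinearMap.ker R'.mulVecLin)
  rw [h, finrank_top, finrank_fin_fun] at hadd
  have := hfinrank hR
  have := hfinrank hR'
  omega

theorem map_mul_contraction_mulVec_veronese_mem_span {d l m N : ℕ} (h : m + d = N + 1)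
    (G : Matrix (Fin l) (Fin m) ℝ) (f : Fin d → ℝ) (s t : ℂ) :
    (G * contraction m N f).map ofReal *ᵥ veronese N s t ∈
      Submodule.span ℂ {G.map ofReal *ᵥ veronese m s t} := by
  rw [map_ofReal_mul, map_ofReal_contraction, ← mulVec_mulVec, contraction_mulVec_veronese h,
    mulVec_smul]
  exact Submodule.smul_mem _ _ (Submodule.mem_span_singleton_self _)

namespace Configuration

variable [Nontrivial (Fin n)] {A : Configuration n} {M : GL (Fin 4) ℝ}

theorem isCritical_of_forall_ne_center_mem (hX : A.points ⊆ veroneseCurve M.val) {l : Fin n}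
    (hl : ∀ m, m ≠ l → A.center m ∈ veroneseCurve M.val) : A.IsCritical := by
  let R (m : Fin n) := (A.camera m).mat * M.val
  have hR (m : Fin n) : Function.Surjective (R m).mulVec :=
    (A.camera m).mat_mul_mulVec_surjective M
  choose! f _ G hG hRG using fun m hm => exists_eq_mul_contraction_of_center_mem (hl m hm)
  obtain ⟨g, hg, hgg, hgW⟩ := exists_forms_root_notMem fun m =>
    ker_sup_ker_ne_top (by omega) (hR l) (hR m)
  let Q : Fin n → Matrix (Fin 3) (Fin 4) ℝ :=
    Function.update (fun m => G m * contraction 3 4 (g m)) l (R l)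
  have hQl : Q l = R l := Function.update_self ..
  have hQm {m : Fin n} (hm : m ≠ l) : Q m = G m * contraction 3 4 (g m) :=
    Function.update_of_ne hm ..
  have hQ (m : Fin n) : Function.Surjective (Q m).mulVec := by
    rcases eq_or_ne m l with rfl | hm
    · exact hQl ▸ hR m
    · rw [hQm hm]
      exact mul_mulVec_surjective (hG m hm) (contraction_mulVec_surjective (by omega) (hg m))
  have hne (i j : Fin n) (hij : i ≠ j) (hj : j ≠ l) :
      ¬epipole (Q i) (Q j) ≤ epipole (R i) (R j) := by
    intro hle
    apply hgW j j
    rcases eq_or_ne i l with rfl | hi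
    · rw [hQl, hQm hj] at hle
      exact ker_le_sup_ker_of_epipole_le hle
        ((mul_mulVec_eq_zero_iff (hG j hj)).2 (contraction_mulVec_root_self 3 (g j)))
    · refine Submodule.mem_sup_right ?_
      simp only [R, hQm hi, hQm hj, hRG i hi, hRG j hj] at hle ⊢
      exact mul_contraction_mulVec_root_eq_zero_of_epipole_le (hG i hi) (hG j hj) (hg j)
        (hgg hij) hle
  have hcommon (s t : ℂ) (m : Fin n) : ∃ u : Fin 3 → ℂ,
      (R m).map ofReal *ᵥ veronese 4 s t ∈ Submodule.span ℂ {u} ∧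
        (Q m).map ofReal *ᵥ veronese 4 s t ∈ Submodule.span ℂ {u} := by
    rcases eq_or_ne m l with rfl | hm
    · exact ⟨_, Submodule.mem_span_singleton_self _, hQl ▸ Submodule.mem_span_singleton_self _⟩
    · rw [hQm hm, show R m = _ from hRG m hm]
      exact ⟨_, map_mul_contraction_mulVec_veronese_mem_span (by omega) (G m) (f m) s t,
        map_mul_contraction_mulVec_veronese_mem_span (by omega) (G m) (g m) s t⟩
  obtain ⟨B, -, -, hB⟩ := exists_isNontrivialConjugate_of_subset_veroneseCurve hX hQ hne Set.univ
    fun s t hst => ⟨_, veronese_ne_zero 3 hst, Set.mem_univ _, hcommon s t⟩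
  exact ⟨B, hB⟩

end Configuration

theorem exists_smul_eq_of_dotProduct_root_eq_zero {f g : Fin 2 → ℝ} (hf : f ≠ 0)
    (h : f ⬝ᵥ root 2 g = 0) : ∃ c : ℝ, c • f = g := by
  have hker : contraction 1 2 f *ᵥ root 2 g = 0 := by
    rw [contraction_mulVec_root (by omega), h, zero_smul]
  obtain ⟨c, hc⟩ := (contraction_mulVec_eq_zero_iff hf).1 hker
  refine ⟨c, funext (Fin.forall_fin_two.2 ⟨?_, ?_⟩)⟩
  · simpa [root, veronese] using congrFun hc 1
  · simpa [root, veronese] using congrFun hc 0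

theorem exists_eq_mul_of_mulVec_eq_zero {ι : Type*} {k l : ℕ} {w : Fin (l + 1) → ℝ} (hw : w ≠ 0)
    {N : ι → Matrix (Fin k) (Fin (l + 1)) ℝ} (hN : ∀ i, Function.Surjective (N i).mulVec)
    (hNw : ∀ i, N i *ᵥ w = 0) :
    ∃ E : Matrix (Fin l) (Fin (l + 1)) ℝ, Function.Surjective E.mulVec ∧ E *ᵥ w = 0 ∧
      ∃ Q : ι → Matrix (Fin k) (Fin l) ℝ, (∀ i, Function.Surjective (Q i).mulVec) ∧
        ∀ i, N i = Q i * E := by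
  obtain ⟨E, hE, hEw⟩ := exists_mulVec_eq_zero_iff_smul hw
  have hker (i : ι) (x : Fin (l + 1) → ℝ) (hx : E *ᵥ x = 0) : N i *ᵥ x = 0 := by
    obtain ⟨c, rfl⟩ := (hEw x).1 hx
    rw [mulVec_smul, hNw, smul_zero]
  choose Q hQ using fun i => exists_eq_mul_of_ker_le hE (hker i)
  refine ⟨E, hE, (hEw w).2 ⟨1, one_smul ℝ w⟩, Q, fun i => ?_, hQ⟩
  refine Function.Surjective.of_comp (g := E.mulVec) ?_
  simpa only [Function.comp_def, mulVec_mulVec, ← hQ] using hN i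

theorem map_mulVec_veronese_ne_zero {l : ℕ} {E : Matrix (Fin (l + 1)) (Fin (l + 2)) ℝ}
    (hE : Function.Surjective E.mulVec) {w : Fin (l + 2) → ℝ} (hEw : E *ᵥ w = 0)
    (hw : ∀ f : Fin 2 → ℝ, contraction (l + 1) (l + 2) f *ᵥ w = 0 → f = 0) {s t : ℂ}
    (hst : s ≠ 0 ∨ t ≠ 0) : E.map ofReal *ᵥ veronese (l + 2) s t ≠ 0 := by
  intro h0
  obtain ⟨f, hf0, hf⟩ := exists_real_contraction (vec_neg_ne_zero hst)
  obtain ⟨c, hc⟩ := (mulVec_eq_zero_iff_of_surjective (map_ofReal_mulVec_surjective hE)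
    (veronese_ne_zero _ hst) h0).1 (map_ofReal_mulVec_eq_zero_iff.2 hEw)
  refine hf0 (hw f (hf w ?_))
  rw [← hc, mulVec_smul, ← root_eq_veronese, contraction_mulVec_root_self, smul_zero]

theorem not_epipole_mul_contraction_le_of_isUnit {l : ℕ} {k : Fin 3 → ℝ}
    {G : Matrix (Fin 3) (Fin 3) ℝ} (hG : IsUnit G) {R : Matrix (Fin l) (Fin 4) ℝ}
    (hR : ∀ x, R *ᵥ x = 0 → contraction 2 4 k *ᵥ x = 0) (f : Fin 2 → ℝ) {g : Fin 2 → ℝ}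
    (hg : g ≠ 0) (hkg : k ⬝ᵥ root 3 g ≠ 0) :
    ¬epipole (G * contraction 3 5 k) (R * contraction 4 5 g) ≤
      epipole (G * contraction 3 4 f) R := by
  intro hle
  obtain ⟨v, hv, hGv⟩ := exists_mulVec_eq_of_epipole_le hle (x := root 5 g) (by
    rw [← mulVec_mulVec, contraction_mulVec_root_self, mulVec_zero])
  rw [← mulVec_mulVec, ← mulVec_mulVec] at hGv
  replace hGv := mulVec_injective_iff_isUnit.2 hG hGv
  rw [contraction_mulVec_root (by omega)] at hGv
  have hcomm := contraction_mulVec_comm (l := 1) (m := 3) (m' := 2) (by omega) (by omega)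
    (by omega) (by omega) k f v
  rw [hR v hv, hGv, mulVec_zero, mulVec_smul, contraction_mulVec_root (by omega)] at hcomm
  exact smul_ne_zero hkg (smul_ne_zero hkg (root_ne_zero 0 hg)) hcomm

theorem not_epipole_mul_contraction_le {l l' : ℕ} {k : Fin 3 → ℝ}
    {R : Matrix (Fin l) (Fin 4) ℝ} (hR : ∀ x, R *ᵥ x = 0 → contraction 2 4 k *ᵥ x = 0)
    {R' : Matrix (Fin l') (Fin 4) ℝ} (hR' : ∀ x, R' *ᵥ x = 0 → contraction 2 4 k *ᵥ x = 0)
    {f g : Fin 2 → ℝ} (hg : g ≠ 0) (hfg : f ⬝ᵥ root 2 g ≠ 0) (hkg : k ⬝ᵥ root 3 g ≠ 0) :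
    ¬epipole (R * contraction 4 5 f) (R' * contraction 4 5 g) ≤ epipole R R' := by
  intro hle
  obtain ⟨v, hv, hRv⟩ := exists_mulVec_eq_of_epipole_le hle (x := root 5 g) (by
    rw [← mulVec_mulVec, contraction_mulVec_root_self, mulVec_zero])
  rw [← mulVec_mulVec, contraction_mulVec_root (by omega), ← sub_eq_zero, ← mulVec_sub] at hRv
  have hk := hR _ hRv
  rw [mulVec_sub, hR' v hv, zero_sub, neg_eq_zero, mulVec_smul,
    contraction_mulVec_root (by omega)] at hk
  exact smul_ne_zero hfg (smul_ne_zero hkg (root_ne_zero 1 hg)) hk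

theorem exists_quartic_lift [Nontrivial (Fin n)] {A : Configuration n} {M : GL (Fin 4) ℝ}
    {i : Fin n} (hoff : ∀ m, m ≠ i → A.center m ∉ veroneseCurve M.val) {k : Fin 3 → ℝ} (hk : k ≠ 0)
    (hR : ∀ m, m ≠ i → ∀ x, ((A.camera m).mat * M.val) *ᵥ x = 0 → contraction 2 4 k *ᵥ x = 0) :
    ∃ w : Fin 5 → ℝ, contraction 3 5 k *ᵥ w = 0 ∧
      (∀ f : Fin 2 → ℝ, contraction 4 5 f *ᵥ w = 0 → f = 0) ∧
      ∃ f : Fin n → Fin 2 → ℝ, ∀ m, m ≠ i → f m ≠ 0 ∧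
        ((A.camera m).mat * M.val) *ᵥ contraction 4 5 (f m) *ᵥ w = 0 ∧
        k ⬝ᵥ root 3 (f m) ≠ 0 ∧ ∀ j, j ≠ i → j ≠ m → f m ⬝ᵥ root 2 (f j) ≠ 0 := by
  choose p hp0 hp using fun m => exists_ne_zero_mulVec_eq_zero ((A.camera m).mat * M.val)
  have hpf (m : Fin n) (hm : m ≠ i) (f : Fin 2 → ℝ) (hfp : contraction 3 4 f *ᵥ p m = 0) :
      f = 0 := by
    by_contra hf
    exact hoff m hm (center_mem_of_contraction_eq_zero hf (hp0 m) (hp m) hfp)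
  obtain ⟨m₀, hm₀⟩ := exists_ne i
  obtain ⟨w, hkw, hw, hkerw⟩ := exists_forall_contraction_mulVec_eq (m := 2) (by omega) hk
    (hR m₀ hm₀ _ (hp m₀)) (hpf m₀ hm₀)
  choose! f hf using fun m hm => hkerw (p m) (hR m hm _ (hp m))
  have hf0 (m : Fin n) (hm : m ≠ i) : f m ≠ 0 := by
    intro h0
    apply hp0 m
    rw [← hf m hm, h0, map_zero, zero_mulVec]
  refine ⟨w, hkw, hw, f, fun m hm => ⟨hf0 m hm, ?_, ?_, fun j hj hjm hfj => ?_⟩⟩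
  · rw [hf m hm, hp m]
  · refine dotProduct_root_ne_zero (m := 3) (by omega) hk (hf0 m hm) hkw fun g hg => ?_
    rw [hf m hm] at hg
    exact hpf m hm g hg
  · obtain ⟨c, hc⟩ := exists_smul_eq_of_dotProduct_root_eq_zero (hf0 m hm) hfj
    have hpj : c • p m = p j := by rw [← hf m hm, ← hf j hj, ← hc, map_smul, smul_mulVec]
    have hpm : ((A.camera m).mat * M.val) *ᵥ p j = 0 := by rw [← hpj, mulVec_smul, hp, smul_zero]
    have := Camera.eq_zero_of_center_ne (A.distinct.ne hjm) (v := M.val *ᵥ p j)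
      (by rw [mulVec_mulVec, hp]) (by rw [mulVec_mulVec, hpm])
    rw [← mulVec_zero M.val] at this
    exact hp0 j (mulVec_injective_iff_isUnit.2 M.isUnit this)

namespace Configuration

variable [Nontrivial (Fin n)] {A : Configuration n} {M : GL (Fin 4) ℝ}

theorem isCritical_of_projection (hX : A.points ⊆ veroneseCurve M.val) {w : Fin 5 → ℝ}
    (hw : ∀ f : Fin 2 → ℝ, contraction 4 5 f *ᵥ w = 0 → f = 0)
    {N : Fin n → Matrix (Fin 3) (Fin 5) ℝ} (hN : ∀ m, Function.Surjective (N m).mulVec)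
    (hNw : ∀ m, N m *ᵥ w = 0) {i : Fin n}
    (hne : ∀ m j, m ≠ j → j ≠ i → ¬epipole (N m) (N j) ≤
      epipole ((A.camera m).mat * M.val) ((A.camera j).mat * M.val))
    (hN' : ∀ (s t : ℂ) (m : Fin n), ∃ u : Fin 3 → ℂ,
      ((A.camera m).mat * M.val).map ofReal *ᵥ veronese 4 s t ∈ Submodule.span ℂ {u} ∧
        (N m).map ofReal *ᵥ veronese 5 s t ∈ Submodule.span ℂ {u}) : A.IsCritical := by
  have hw0 : w ≠ 0 := fun h0 => one_ne_zero (hw 1 (by rw [h0, mulVec_zero]))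
  obtain ⟨E, hE, hEw, Q, hQ, hNQ⟩ := exists_eq_mul_of_mulVec_eq_zero hw0 hN hNw
  simp only [hNQ, epipole_mul_right hE] at hne
  simp only [hNQ, map_ofReal_mul, ← mulVec_mulVec] at hN'
  obtain ⟨B, -, -, hB⟩ := exists_isNontrivialConjugate_of_subset_veroneseCurve hX hQ hne Set.univ
    fun s t hst => ⟨_, map_mulVec_veronese_ne_zero hE hEw hw hst, Set.mem_univ _,
      by simpa only [map_ofReal_mul, ← mulVec_mulVec] using hN' s t⟩
  exact ⟨B, hB⟩

theorem isCritical_of_isSecant (hX : A.points ⊆ veroneseCurve M.val) {i : Fin n}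
    (hi : A.center i ∈ veroneseCurve M.val) (hoff : ∀ m, m ≠ i → A.center m ∉ veroneseCurve M.val)
    {L : Set (ProjSpace 3)} (hL : IsSecant L (veroneseCurve M.val))
    (hAL : ∀ m, m ≠ i → A.center m ∈ L) : A.IsCritical := by
  let R (m : Fin n) := (A.camera m).mat * M.val
  have hR (m : Fin n) : Function.Surjective (R m).mulVec :=
    (A.camera m).mat_mul_mulVec_surjective M
  obtain ⟨f₀, -, G, hG, hRG⟩ := exists_eq_mul_contraction_of_center_mem hi
  obtain ⟨k, hk, hkL⟩ := exists_contraction_eq_zero_of_isSecant hL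
  have hRk (m : Fin n) (hm : m ≠ i) := hkL _ (hAL m hm)
  obtain ⟨w, hkw, hw, f, hf⟩ := exists_quartic_lift hoff hk hRk
  let N : Fin n → Matrix (Fin 3) (Fin 5) ℝ :=
    Function.update (fun m => R m * contraction 4 5 (f m)) i (G * contraction 3 5 k)
  have hNi : N i = G * contraction 3 5 k := Function.update_self ..
  have hNm {m : Fin n} (hm : m ≠ i) : N m = R m * contraction 4 5 (f m) :=
    Function.update_of_ne hm ..
  have hN (m : Fin n) : Function.Surjective (N m).mulVec ∧ N m *ᵥ w = 0 := by
    rcases eq_or_ne m i with rfl | hm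
    · rw [hNi, ← mulVec_mulVec, hkw, mulVec_zero]
      exact ⟨mul_mulVec_surjective hG (contraction_mulVec_surjective (by omega) hk), rfl⟩
    · rw [hNm hm, ← mulVec_mulVec]
      refine ⟨?_, (hf m hm).2.1⟩
      simpa only [Function.comp_def, mulVec_mulVec] using
        (hR m).comp (contraction_mulVec_surjective (by omega) (hf m hm).1)
  refine isCritical_of_projection hX hw (fun m => (hN m).1) (fun m => (hN m).2) (i := i)
    (fun m j hmj hj => ?_) fun s t m => ?_
  · rw [hNm hj]
    obtain ⟨hfj, -, hkj, -⟩ := hf j hj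
    rcases eq_or_ne m i with rfl | hm
    · rw [hNi, hRG]
      exact not_epipole_mul_contraction_le_of_isUnit hG (hRk j hj) f₀ hfj hkj
    · rw [hNm hm]
      exact not_epipole_mul_contraction_le (hRk m hm) (hRk j hj) hfj
        ((hf m hm).2.2.2 j hj hmj.symm) hkj
  · rcases eq_or_ne m i with rfl | hm
    · rw [hNi, hRG]
      exact ⟨_, map_mul_contraction_mulVec_veronese_mem_span (by omega) G f₀ s t,
        map_mul_contraction_mulVec_veronese_mem_span (by omega) G k s t⟩
    · rw [hNm hm]
      exact ⟨_, Submodule.mem_span_singleton_self _,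
        map_mul_contraction_mulVec_veronese_mem_span (by omega) (R m) (f m) s t⟩

end Configuration

/-- The embedding of the plane `ℙ²` into `ℙ³` as the plane where the last coordinate vanishes. -/
def planeEmbedding : Matrix (Fin 4) (Fin 3) ℝ :=
  !![1, 0, 0; 0, 1, 0; 0, 0, 1; 0, 0, 0]

/-- The projection of `ℙ³` onto the plane where the last coordinate vanishes, from the point
`[0 : r : 0 : 1]`. -/
def planeProjection (r : ℝ) : Matrix (Fin 3) (Fin 4) ℝ :=
  !![1, 0, 0, 0; 0, 1, 0, -r; 0, 0, 1, 0]

theorem planeProjection_mul_planeEmbedding (r : ℝ) : planeProjection r * planeEmbedding = 1 := by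
  ext i j
  fin_cases i <;> fin_cases j <;>
    simp [planeProjection, planeEmbedding, Matrix.mul_apply, Fin.sum_univ_four]

theorem planeProjection_mulVec (q r : ℝ) :
    planeProjection q *ᵥ ![0, r, 0, 1] = Pi.single 1 (r - q) := by
  ext i
  fin_cases i <;> simp [planeProjection, sub_eq_add_neg]

theorem planeProjection_mulVec_surjective (r : ℝ) :
    Function.Surjective (planeProjection r).mulVec :=
  mulVec_surjective_iff_exists_right_inverse.2 ⟨_, planeProjection_mul_planeEmbedding r⟩

theorem rank_planeEmbedding : planeEmbedding.rank = 3 := by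
  refine le_antisymm planeEmbedding.rank_le_width ?_
  simpa only [planeProjection_mul_planeEmbedding, rank_one, Fintype.card_fin] using
    rank_mul_le_right (planeProjection 0) planeEmbedding

theorem map_mul_planeProjection_mulVec (G : Matrix (Fin 3) (Fin 3) ℝ) (r : ℝ) (v : Fin 3 → ℂ) :
    (G * planeProjection r).map ofReal *ᵥ (planeEmbedding.map ofReal *ᵥ v) =
      G.map ofReal *ᵥ v := by
  rw [mulVec_mulVec, ← map_ofReal_mul, Matrix.mul_assoc, planeProjection_mul_planeEmbedding,
    Matrix.mul_one]

theorem not_epipole_mul_planeProjection_le {l : ℕ} {G : Matrix (Fin 3) (Fin 3) ℝ} (hG : IsUnit G)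
    (G' : Matrix (Fin l) (Fin 3) ℝ) {q r : ℝ} (hqr : q ≠ r) (f : Fin 2 → ℝ) {g : Fin 2 → ℝ}
    (hg : g ≠ 0) {R : Matrix (Fin l) (Fin 4) ℝ}
    (hR : ∀ x, R *ᵥ x = 0 → contraction 3 4 g *ᵥ x = 0) :
    ¬epipole (G * planeProjection q) (G' * planeProjection r) ≤
      epipole (G * contraction 3 4 f) R := by
  intro hle
  obtain ⟨v, hv, hGv⟩ := exists_mulVec_eq_of_epipole_le hle (x := ![0, r, 0, 1]) (by
    rw [← mulVec_mulVec, planeProjection_mulVec, sub_self, Pi.single_zero, mulVec_zero])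
  obtain ⟨c, rfl⟩ := (contraction_mulVec_eq_zero_iff hg).1 (hR v hv)
  rw [← mulVec_mulVec, ← mulVec_mulVec] at hGv
  replace hGv := mulVec_injective_iff_isUnit.2 hG hGv
  rw [planeProjection_mulVec, mulVec_smul, contraction_mulVec_root (by omega), smul_smul] at hGv
  generalize c * f ⬝ᵥ root 2 g = a at hGv
  have h0 : a = 0 ∨ g 1 = 0 := by simpa [root, veronese] using congrFun hGv 0
  have h1 : a * (g 1 * -g 0) = r - q := by simpa [root, veronese] using congrFun hGv 1
  refine sub_ne_zero.2 hqr.symm (h1.symm.trans ?_)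
  rcases h0 with h0 | h0 <;> simp [h0]

namespace Configuration

variable [Nontrivial (Fin n)] {A : Configuration n} {M : GL (Fin 4) ℝ}

theorem exists_isNontrivialConjugate_isConic (hX : A.points ⊆ veroneseCurve M.val)
    (hC : ∀ i, A.center i ∈ veroneseCurve M.val) :
    ∃ B, A.IsNontrivialConjugate B ∧ ∃ D, IsConic D ∧ B.points ⊆ D ∧ ∀ i, B.center i ∉ D := by
  choose f hf G hG hR using fun i => exists_eq_mul_contraction_of_center_mem (hC i)
  obtain ⟨l, -, -⟩ := exists_pair_ne (Fin n)
  have hne (i j : Fin n) (hij : i ≠ j) (_ : j ≠ l) :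
      ¬epipole (G i * planeProjection (i : ℕ)) (G j * planeProjection (j : ℕ)) ≤
        epipole ((A.camera i).mat * M.val) ((A.camera j).mat * M.val) := by
    rw [hR, hR]
    exact not_epipole_mul_planeProjection_le (hG i) (G j)
      (Nat.cast_injective.ne (Fin.val_injective.ne hij)) (f i) (hf j)
      fun x => (mul_mulVec_eq_zero_iff (hG j)).1
  have hcommon (s t : ℂ) (i : Fin n) : ∃ u : Fin 3 → ℂ,
      ((A.camera i).mat * M.val).map ofReal *ᵥ veronese 4 s t ∈ Submodule.span ℂ {u} ∧
        (G i * planeProjection (i : ℕ)).map ofReal *ᵥ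
          (planeEmbedding.map ofReal *ᵥ veronese 3 s t) ∈ Submodule.span ℂ {u} := by
    rw [hR, map_mul_planeProjection_mulVec]
    exact ⟨_, map_mul_contraction_mulVec_veronese_mem_span (by omega) (G i) (f i) s t,
      Submodule.mem_span_singleton_self _⟩
  have hembedding {v : Fin 3 → ℂ} {i : Fin n} (hv : (G i * planeProjection (i : ℕ)).map ofReal *ᵥ
      (planeEmbedding.map ofReal *ᵥ v) = 0) : v = 0 := by
    rw [map_mul_planeProjection_mulVec] at hv
    exact map_ofReal_mulVec_injective (hG i) (hv.trans (mulVec_zero _).symm)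
  obtain ⟨B, hB, hBD, hAB⟩ := exists_isNontrivialConjugate_of_subset_veroneseCurve hX
    (fun i => mul_mulVec_surjective (hG i) (planeProjection_mulVec_surjective (i : ℕ))) hne
    (veroneseCurve planeEmbedding) fun s t hst =>
      have hy : planeEmbedding.map ofReal *ᵥ veronese 3 s t ≠ 0 := fun h0 =>
        veronese_ne_zero 2 hst (hembedding (i := l) (by rw [h0, mulVec_zero]))
      ⟨_, hy, ⟨s, t, hy, rfl⟩, hcommon s t⟩
  refine ⟨B, hAB, _, isConic_iff.2 ⟨_, rank_planeEmbedding, rfl⟩, hBD, ?_⟩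
  rintro i ⟨s, t, hy, hc⟩
  have hker : planeEmbedding.map ofReal *ᵥ veronese 3 s t ∈ LinearMap.ker (B.camera i).lin := by
    rw [Camera.ker_lin, show (B.camera i).center = _ from hc, Projectivization.submodule_mk]
    exact Submodule.mem_span_singleton_self _
  rw [Camera.lin, hB] at hker
  exact hy (by rw [hembedding hker, mulVec_zero])

end Configuration

end Conjugates

theorem mainTheorem9_general {n : ℕ} [Nontrivial (Fin n)] (A : Configuration n)
    (C : Set (ProjSpace 3)) (hC : IsTwistedCubic C) (hX : A.points ⊆ C) :
    (∀ l, (∀ m, m ≠ l → A.center m ∈ C) → A.IsCritical) ∧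
    (∀ i, A.center i ∈ C → (∀ m, m ≠ i → A.center m ∉ C) →
      (∃ L, IsSecant L C ∧ ∀ m, m ≠ i → A.center m ∈ L) → A.IsCritical) ∧
    ((∀ i, A.center i ∈ C) →
      ∃ B, A.IsNontrivialConjugate B ∧ ∃ D, IsConic D ∧ B.points ⊆ D ∧ ∀ i, B.center i ∉ D) := by
  obtain ⟨M, rfl⟩ := isTwistedCubic_iff.1 hC
  exact ⟨fun _ => Configuration.isCritical_of_forall_ne_center_mem hX,
    fun _ hi hoff ⟨_, hL, hAL⟩ => Configuration.isCritical_of_isSecant hX hi hoff hL hAL,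
    Configuration.exists_isNontrivialConjugate_isConic hX⟩

theorem mainTheorem9 (A : Configuration 3) (C : Set (ProjSpace 3)) (hC : IsTwistedCubic C)
    (hX : A.points ⊆ C) :
    (∀ i j : Fin 3, i ≠ j → A.center i ∈ C → A.center j ∈ C → A.IsCritical) ∧
    (∀ i j k : Fin 3, i ≠ j → i ≠ k → j ≠ k →
      A.center i ∈ C → A.center j ∉ C → A.center k ∉ C →
      (∃ L, IsSecant L C ∧ A.center j ∈ L ∧ A.center k ∈ L) → A.IsCritical) ∧
    ((∀ i : Fin 3, A.center i ∈ C) →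
      A.IsCritical ∧
      ∃ B : Configuration 3, A.IsNontrivialConjugate B ∧
        ∃ D, IsConic D ∧ B.points ⊆ D ∧ ∀ i, B.center i ∉ D) := by
  obtain ⟨h₁, h₂, h₃⟩ := mainTheorem9_general A C hC hX
  -- The three camera indices add up to zero in `Fin 3`, so `-(i + j)` is the third one.
  exact ⟨fun i j hij hi hj => h₁ (-(i + j)) (by grind),
    fun i j k hij hik hjk hi hj hk ⟨L, hL, hjL, hkL⟩ => h₂ i hi (by grind) ⟨L, hL, by grind⟩,
    fun h => ⟨(h₃ h).imp fun _ => And.left, h₃ h⟩⟩
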